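/- Let $A$ be a finite linearly ordered alphabet. A (numerical monadic) predicate is a family $\mathbf{P}=(\mathbf{P}_n)_{n\in\mathbb{N}}$ with $\mathbf{P}_n\subseteq\{0,\dots,n-1\}$. MSO formulae over words are built from $\mathbf{a}(x)$ ($a\in A$), $x\le y$, $x\in X$, and $P(x)$ for predicate symbols $P$, by Boolean connectives and quantification over positions and over sets of positions; in a word of length $n$, $P(x)$ means $x\in\mathbf{P}_n$. A language $L\subseteq A^*$ is in $\mathrm{MSO}[\le,\overline{\mathbf{P}}]$ if it is defined by a sentence with predicates from the tuple $\overline{\mathbf{P}}$. It is advice regular if it is in $\mathrm{MSO}[\le,\overline{\mathbf{P}}]$ for some finite tuple $\overline{\mathbf{P}}$ of arbitrary predicates. A predicate $\mathbf{R}$ is in $\mathrm{MSO}[\le,\overline{\mathbf{P}}]$ if there is an MSO formula $\varphi(x)$ over a one-letter alphabet $\{a\}$ with $\mathbf{R}_n=\{x<n : a^n,\overline{\mathbf{P}},x\models\varphi\}$ for all $n$; it is regular if it is in $\mathrm{MSO}[\le]$ (no predicates). A tuple of predicates is in $\mathrm{MSO}[\le,\overline{\mathbf{P}}]$ (respectively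 regular) if each of its components is. For $L\subseteq A^*$ and $p\in\mathbb{N}$ write $u\sim_{L,p}v$ if for all $w\in A^p$ we have $uw\in L\Leftrightarrow vw\in L$. For $i\le n$ let $u^{i,n}_0,u^{i,n}_1,\dots$ be, in increasing lexicographic order, the words of length $i$ that are lexicographically minimal among the words of length $i$ in their $\sim_{L,n-i}$-class. If $K$ bounds, for all $i,p$, the number of $\sim_{L,p}$-classes of words of length $i$, the syntactical predicate $\mathbf{P}_L$ of $L$ (with index set $Q=\{0,\dots,K-1\}$) is the tuple of the following predicates, for $q,q'\in Q$ and $a\in A$: a position $i<n$ is in $(\mathbf{P}_{L,q,a,q'})_n$ iff $u^{i,n}_q$ and $u^{i+1,n}_{q'}$ exist and $u^{i,n}_q\,a\sim_{L,n-i-1}u^{i+1,n}_{q'}$; and $(\mathbf{P}_{L,q})_n$ is $\{n-1\}$ if $n\ge1$, $u^{n,n}_q$ exists and $u^{n,n}_q\in L$, and is empty otherwise. Theorem. Let $L\subseteq A^*$ be advice regular. Then a bound $K$ as above exists, and for every such $K$ the corresponding syntactical predicate $\mathbf{P}_L$ satisfies: (1) $L\in\mathrm{MSO}[\le,\mathbf{P}_L]$;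 (2) for every finite tuple $\overline{\mathbf{P}}$ of predicates with $L\in\mathrm{MSO}[\le,\overline{\mathbf{P}}]$, we have $\mathbf{P}_L\in\mathrm{MSO}[\le,\overline{\mathbf{P}}]$; (3) $L$ is regular if and only if $\mathbf{P}_L$ is regular. -/

import Mathlib

/-- A numerical monadic predicate `P = (P_n)`: for each length `n`, a set of positions
`P_n ⊆ {0, …, n-1}`. -/
abbrev NumPred : Type := ∀ n : ℕ, Set (Fin n)

/-- Monadic second-order formulae over the alphabet `A` with numerical monadic predicate symbols
in `ι`, whose free first-order variables are among `x_0, …, x_{p-1}` and whose free second-order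
variables are among `X_0, …, X_{q-1}`. A quantifier binds the variable of index `0` and shifts
the other variables of its sort. -/
inductive MSO (A : Type*) (ι : Type*) : ℕ → ℕ → Type _
  | letter {p q : ℕ} (a : A) (x : Fin p) : MSO A ι p q
  | le {p q : ℕ} (x y : Fin p) : MSO A ι p q
  | mem {p q : ℕ} (x : Fin p) (X : Fin q) : MSO A ι p q
  | pred {p q : ℕ} (s : ι) (x : Fin p) : MSO A ι p q
  | and {p q : ℕ} (φ ψ : MSO A ι p q) : MSO A ι p q
  | not {p q : ℕ} (φ : MSO A ι p q) : MSO A ι p q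
  | existsPos {p q : ℕ} (φ : MSO A ι (p + 1) q) : MSO A ι p q
  | existsSet {p q : ℕ} (φ : MSO A ι p (q + 1)) : MSO A ι p q

/-- `φ.Sat u P x X` : the word `u` of length `n`, the predicates `P` and the valuations `x`, `X`
satisfy `φ`. -/
def MSO.Sat {A : Type*} {ι : Type*} {n : ℕ} (u : Fin n → A) (P : ι → NumPred) :
    {p q : ℕ} → MSO A ι p q → (Fin p → Fin n) → (Fin q → Set (Fin n)) → Prop
  | _, _, .letter a y, x, _ => u (x y) = a
  | _, _, .le y z, x, _ => x y ≤ x z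
  | _, _, .mem y Y, x, X => x y ∈ X Y
  | _, _, .pred s y, x, _ => x y ∈ P s n
  | _, _, .and φ ψ, x, X => φ.Sat u P x X ∧ ψ.Sat u P x X
  | _, _, .not φ, x, X => ¬ φ.Sat u P x X
  | _, _, .existsPos φ, x, X => ∃ i : Fin n, φ.Sat u P (Fin.cons i x) X
  | _, _, .existsSet φ, x, X => ∃ S : Set (Fin n), φ.Sat u P x (Fin.cons S X)

/-- The language `L_{φ,P}` defined by a sentence `φ` and predicates `P`. -/
def MSO.language {A : Type*} {ι : Type*} (φ : MSO A ι 0 0) (P : ι → NumPred) : Language A :=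
  {w : List A | φ.Sat w.get P Fin.elim0 Fin.elim0}

/-- `L ∈ MSO[≤, P]`. -/
def LanguageDefinable {A : Type*} {ι : Type*} (P : ι → NumPred) (L : Language A) : Prop :=
  ∃ φ : MSO A ι 0 0, φ.language P = L

/-- `R ∈ MSO[≤, P]` for a numerical predicate `R`: there is a formula `φ(x)` over a one-letter
alphabet `{a}` such that `R_n = {x < n | a^n, P, x ⊨ φ}` for all `n`. -/
def PredicateDefinable {ι : Type*} (P : ι → NumPred) (R : NumPred) : Prop :=
  ∃ φ : MSO Unit ι 1 0, ∀ n : ℕ,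
    R n = {i : Fin n | φ.Sat (fun _ : Fin n => ()) P (fun _ => i) Fin.elim0}

/-- A numerical predicate is regular if it is definable in `MSO[≤]`, without any predicates. -/
def NumPred.IsRegular (R : NumPred) : Prop :=
  PredicateDefinable (Fin.elim0 : Fin 0 → NumPred) R

/-- A language is advice regular if it is in `MSO[≤, Arb₁]`, that is, defined by an MSO sentence
and finitely many arbitrary numerical monadic predicates. -/
def AdviceRegular {A : Type*} (L : Language A) : Prop :=
  ∃ (k : ℕ) (P : Fin k → NumPred), LanguageDefinable P L

/-- The equivalence `u ∼_{L,p} v`. -/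
def MNEquiv {A : Type*} (L : Language A) (p : ℕ) (u v : List A) : Prop :=
  ∀ w : List A, w.length = p → (u ++ w ∈ L ↔ v ++ w ∈ L)

/-- The restriction of `∼_{L,p}` to the words of length `i`. -/
def mnSetoid {A : Type*} (L : Language A) (p i : ℕ) : Setoid {u : List A // u.length = i} where
  r u v := MNEquiv L p u.1 v.1
  iseqv :=
    { refl := fun _ _ _ => Iff.rfl
      symm := fun h w hw => (h w hw).symm
      trans := fun h h' w hw => (h w hw).trans (h' w hw) }

/-- For all `i, p`, the restriction of `∼_{L,p}` to words of length `i` has at most `K` classes. -/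
def HasClassBound {A : Type*} (L : Language A) (K : ℕ) : Prop :=
  ∀ i p : ℕ, Nat.card (Quotient (mnSetoid L p i)) ≤ K

/-- The words of length `i` that are lexicographically minimal in their class for `∼_{L,n-i}`
among the words of length `i` (used for `i ≤ n`). -/
def minReps {A : Type*} [LinearOrder A] (L : Language A) (n i : ℕ) : Set (List A) :=
  {u | u.length = i ∧
    ∀ v : List A, v.length = i → MNEquiv L (n - i) u v → ¬ List.Lex (· < ·) v u}

/-- `u = u_q^{i,n}`: `u` is the element number `q` (counted from `0`) of the lexicographically
increasing enumeration of the minimal representatives of length `i`. -/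
def IsRep {A : Type*} [LinearOrder A] (L : Language A) (n i q : ℕ) (u : List A) : Prop :=
  u ∈ minReps L n i ∧ {v ∈ minReps L n i | List.Lex (· < ·) v u}.ncard = q

/-- The monadic predicate symbols that make up the syntactical predicate, for the index set
`Q = {0, …, K-1}`. -/
inductive SynSymbol (A : Type*) (K : ℕ)
  | trans (q : Fin K) (a : A) (q' : Fin K) : SynSymbol A K
  | final (q : Fin K) : SynSymbol A K

/-- The syntactical predicate `P_L`, as a tuple of monadic predicates:
position `i < n` is in `trans q a q'` if `u_q^{i,n}` and `u_{q'}^{i+1,n}` exist and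
`u_q^{i,n} a ∼_{L,n-i-1} u_{q'}^{i+1,n}`;
the last position `n-1` is in `final q` if `u_q^{n,n}` exists and belongs to `L`. -/
def synPred {A : Type*} [LinearOrder A] (L : Language A) (K : ℕ) : SynSymbol A K → NumPred
  | .trans q a q', n => {i : Fin n | ∃ u v : List A,
      IsRep L n i q u ∧ IsRep L n (i + 1) q' v ∧ MNEquiv L (n - (i + 1)) (u ++ [a]) v}
  | .final q, n => {i : Fin n | (i : ℕ) + 1 = n ∧ ∃ u : List A, IsRep L n n q u ∧ u ∈ L}

/-! The bridge is the Büchi–Elgot–Trakhtenbrot theorem with advice: `L` is definable with predicates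
`P` iff a finite automaton decides `w ∈ L` by reading `w` zipped with the truth values of `P` at its
positions (`languageDefinable_iff`). Formulae become automata because regular languages are closed
under Boolean operations and letter-to-letter images; an automaton becomes a formula that guesses,
for each state, the set of positions after which the run is in that state.

Fix such an automaton `M`. Words of length `i` that lead to the same state along the advice are
equivalent, so the number of states is a class bound. For (1), the syntactical predicate is a
transition table: an automaton reading it can follow the index of the representative of the current
prefix (`synDFA_recognizesWith`).

For (2), the relevant facts about the representatives at position `i` depend only on finite data:
which states are reachable before `i` and how their least words compare (`reachLE`), the advice at
`i`, and which states the advice after `i` cannot separate. Each is updated letter by letter, so a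
finite automaton reading the advice with `i` marked decides membership in the syntactical predicate
(`DFA.RecognizesWith.mem_synPred_iff`).

For (3), regularity is definability from the empty tuple: one direction is (2) for that tuple, the
other is (1) followed by the elimination of definable predicates (`LanguageDefinable.trans`). -/

/-! ### Closure under letter maps and two elementary regular languages -/

/-- The image of a regular language under a letter-to-letter map is regular. -/
theorem Language.IsRegular.image_map {α : Type*} {β : Type*} {R : Language α} (hR : R.IsRegular)
    (f : α → β) : Language.IsRegular {w : List β | ∃ v ∈ R, v.map f = w} := by
  classical
  obtain ⟨σ, _, M, rfl⟩ := hR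
  -- Subset construction: reading `b` amounts to guessing a preimage of `b` for `M` to read.
  let N : DFA β (Set σ) :=
    { step := fun S b => {t | ∃ s ∈ S, ∃ a, f a = b ∧ M.step s a = t}
      start := {M.start}
      accept := {S | ∃ s ∈ S, s ∈ M.accept} }
  refine ⟨Set σ, Fintype.ofFinite _, N, ?_⟩
  have key : ∀ (w : List β) (t : σ), t ∈ N.eval w ↔ ∃ v : List α, v.map f = w ∧ M.eval v = t := by
    intro w
    induction w using List.reverseRecOn with
    | nil =>
      intro t
      constructor
      · rintro rfl
        exact ⟨[], rfl, rfl⟩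
      · rintro ⟨v, hv, rfl⟩
        rw [List.map_eq_nil_iff] at hv
        subst hv
        rfl
    | append_singleton w b ih =>
      intro t
      rw [DFA.eval_append_singleton]
      constructor
      · rintro ⟨s, hs, a, rfl, rfl⟩
        obtain ⟨v, rfl, rfl⟩ := (ih s).1 hs
        exact ⟨v ++ [a], by simp, by simp⟩
      · rintro ⟨v, hv, rfl⟩
        obtain ⟨v₁, v₂, rfl, rfl, h₂⟩ := List.map_eq_append_iff.1 hv
        obtain ⟨a, rfl, rfl⟩ := List.map_eq_singleton_iff.1 h₂
        exact ⟨M.eval v₁, (ih _).2 ⟨v₁, rfl, rfl⟩, a, rfl, by simp⟩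
  ext w
  change (∃ s ∈ N.eval w, s ∈ M.accept) ↔ ∃ v, M.eval v ∈ M.accept ∧ v.map f = w
  constructor
  · rintro ⟨s, hs, hacc⟩
    obtain ⟨v, rfl, rfl⟩ := (key w s).1 hs
    exact ⟨v, hacc, rfl⟩
  · rintro ⟨v, hacc, rfl⟩
    exact ⟨_, (key _ _).2 ⟨v, rfl, rfl⟩, hacc⟩

/-- The words in which a position satisfying `f` is followed, weakly, by one satisfying `g`. -/
def Language.existsLE {α : Type*} (f g : α → Prop) : Language α :=
  {w : List α | ∃ i j : Fin w.length, i ≤ j ∧ f w[i] ∧ g w[j]}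

/-- The words in which two distinct positions satisfy `f`. -/
def Language.existsLT {α : Type*} (f : α → Prop) : Language α :=
  {w : List α | ∃ i j : Fin w.length, i < j ∧ f w[i] ∧ f w[j]}

theorem Language.ofFn_mem_existsLE {α : Type*} {f g : α → Prop} {n : ℕ} {a : Fin n → α} :
    List.ofFn a ∈ existsLE f g ↔ ∃ i j : Fin n, i ≤ j ∧ f (a i) ∧ g (a j) := by
  constructor
  · rintro ⟨i, j, hij, h, h'⟩
    exact ⟨i.cast (by simp), j.cast (by simp), hij, by simpa [Fin.cast] using h, by simpa [Fin.cast] using h'⟩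
  · rintro ⟨i, j, hij, h, h'⟩
    exact ⟨i.cast (by simp), j.cast (by simp), hij, by simpa using h, by simpa using h'⟩

theorem Language.ofFn_mem_existsLT {α : Type*} {f : α → Prop} {n : ℕ} {a : Fin n → α} :
    List.ofFn a ∈ existsLT f ↔ ∃ i j : Fin n, i < j ∧ f (a i) ∧ f (a j) := by
  constructor
  · rintro ⟨i, j, hij, h, h'⟩
    exact ⟨i.cast (by simp), j.cast (by simp), hij, by simpa [Fin.cast] using h, by simpa [Fin.cast] using h'⟩
  · rintro ⟨i, j, hij, h, h'⟩
    exact ⟨i.cast (by simp), j.cast (by simp), hij, by simpa using h, by simpa using h'⟩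

theorem Language.isRegular_existsLE {α : Type*} (f g : α → Prop) : (existsLE f g).IsRegular := by
  classical
  let N : DFA α (Prop × Prop) :=
    -- The first bit records that `f` has occurred, the current letter included; this makes the
    -- comparison weak.
    { step := fun s c => (s.1 ∨ f c, s.2 ∨ ((s.1 ∨ f c) ∧ g c))
      start := (False, False)
      accept := {s | s.2} }
  refine ⟨_, Fintype.ofFinite _, N, ?_⟩
  have key : ∀ w : List α, ((N.eval w).1 ↔ ∃ i : Fin w.length, f w[i]) ∧
      ((N.eval w).2 ↔ ∃ i j : Fin w.length, i ≤ j ∧ f w[i] ∧ g w[j]) := by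
    intro w
    induction w using List.reverseRecOn with
    | nil => simp [N]
    | append_singleton w b ih =>
      rw [DFA.eval_append_singleton]
      change (((N.eval w).1 ∨ f b) ↔ _) ∧ (((N.eval w).2 ∨ (((N.eval w).1 ∨ f b) ∧ g b)) ↔ _)
      rw [ih.1, ih.2]
      simp only [Fin.exists_iff, Fin.getElem_fin, List.length_append, List.length_singleton,
        Fin.mk_le_mk]
      constructor
      · constructor
        · rintro (⟨i, hi, h⟩ | h)
          · exact ⟨i, by lia, by rwa [List.getElem_append_left hi]⟩
          · exact ⟨w.length, by lia, by simpa⟩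
        · rintro ⟨i, hi, h⟩
          rcases Nat.lt_succ_iff_lt_or_eq.1 hi with hi' | rfl
          · exact Or.inl ⟨i, hi', by rwa [List.getElem_append_left hi'] at h⟩
          · exact Or.inr (by simpa using h)
      · constructor
        · rintro (⟨i, hi, j, hj, hij, h, h'⟩ | ⟨⟨i, hi, h⟩ | h, h'⟩)
          · exact ⟨i, by lia, j, by lia, hij, by rwa [List.getElem_append_left hi],
              by rwa [List.getElem_append_left hj]⟩
          · exact ⟨i, by lia, w.length, by lia, hi.le, by rwa [List.getElem_append_left hi],
              by simpa⟩
          · exact ⟨w.length, by lia, w.length, by lia, le_rfl, by simpa, by simpa⟩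
        · rintro ⟨i, hi, j, hj, hij, h, h'⟩
          rcases Nat.lt_succ_iff_lt_or_eq.1 hj with hj' | rfl
          · have hi' : i < w.length := by lia
            exact Or.inl ⟨i, hi', j, hj', hij, by rwa [List.getElem_append_left hi'] at h,
              by rwa [List.getElem_append_left hj'] at h'⟩
          · refine Or.inr ⟨?_, by simpa using h'⟩
            rcases Nat.lt_succ_iff_lt_or_eq.1 hi with hi' | rfl
            · exact Or.inl ⟨i, hi', by rwa [List.getElem_append_left hi'] at h⟩
            · exact Or.inr (by simpa using h)
  ext w
  exact (key w).2

theorem Language.isRegular_existsLT {α : Type*} (f : α → Prop) : (existsLT f).IsRegular := by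
  classical
  let N : DFA α (Prop × Prop) :=
    -- The second bit tests the first bit before its update, so the two positions are distinct.
    { step := fun s c => (s.1 ∨ f c, s.2 ∨ (s.1 ∧ f c))
      start := (False, False)
      accept := {s | s.2} }
  refine ⟨_, Fintype.ofFinite _, N, ?_⟩
  have key : ∀ w : List α, ((N.eval w).1 ↔ ∃ i : Fin w.length, f w[i]) ∧
      ((N.eval w).2 ↔ ∃ i j : Fin w.length, i < j ∧ f w[i] ∧ f w[j]) := by
    intro w
    induction w using List.reverseRecOn with
    | nil => simp [N]
    | append_singleton w b ih =>
      rw [DFA.eval_append_singleton]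
      change (((N.eval w).1 ∨ f b) ↔ _) ∧ (((N.eval w).2 ∨ ((N.eval w).1 ∧ f b)) ↔ _)
      rw [ih.1, ih.2]
      simp only [Fin.exists_iff, Fin.getElem_fin, List.length_append, List.length_singleton,
        Fin.mk_lt_mk]
      constructor
      · constructor
        · rintro (⟨i, hi, h⟩ | h)
          · exact ⟨i, by lia, by rwa [List.getElem_append_left hi]⟩
          · exact ⟨w.length, by lia, by simpa⟩
        · rintro ⟨i, hi, h⟩
          rcases Nat.lt_succ_iff_lt_or_eq.1 hi with hi' | rfl
          · exact Or.inl ⟨i, hi', by rwa [List.getElem_append_left hi'] at h⟩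
          · exact Or.inr (by simpa using h)
      · constructor
        · rintro (⟨i, hi, j, hj, hij, h, h'⟩ | ⟨⟨i, hi, h⟩, h'⟩)
          · exact ⟨i, by lia, j, by lia, hij, by rwa [List.getElem_append_left hi],
              by rwa [List.getElem_append_left hj]⟩
          · exact ⟨i, by lia, w.length, by lia, hi, by rwa [List.getElem_append_left hi],
              by simpa⟩
        · rintro ⟨i, hi, j, hj, hij, h, h'⟩
          have hi' : i < w.length := by lia
          rcases Nat.lt_succ_iff_lt_or_eq.1 hj with hj' | rfl
          · exact Or.inl ⟨i, hi', j, hj', hij, by rwa [List.getElem_append_left hi'] at h,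
              by rwa [List.getElem_append_left hj'] at h'⟩
          · exact Or.inr ⟨⟨i, hi', by rwa [List.getElem_append_left hi'] at h⟩, by simpa using h'⟩
  ext w
  exact (key w).2

/-! ### From formulae to automata -/

/-- Letters of the words that encode a word together with predicates and a valuation. -/
abbrev EncLetter (A : Type*) (ι : Type*) (p q : ℕ) := A × Set ι × Set (Fin p) × Set (Fin q)

/-- The letter at position `j` of the encoding. -/
def encLetter {A ι : Type*} {n p q : ℕ} (u : Fin n → A) (P : ι → NumPred)
    (x : Fin p → Fin n) (X : Fin q → Set (Fin n)) (j : Fin n) : EncLetter A ι p q :=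
  (u j, {s | j ∈ P s n}, {y | x y = j}, {Y | j ∈ X Y})

/-- The encoding of a word together with predicates and a valuation. -/
def encode {A ι : Type*} {n p q : ℕ} (u : Fin n → A) (P : ι → NumPred)
    (x : Fin p → Fin n) (X : Fin q → Set (Fin n)) : List (EncLetter A ι p q) :=
  List.ofFn (encLetter u P x X)

/-- A condition on one letter of the encoding at some position defines a regular language. -/
theorem exists_regular_of_local {A ι : Type*} {p q : ℕ} (f : EncLetter A ι p q → Prop) :
    ∃ R : Language (EncLetter A ι p q), R.IsRegular ∧
      ∀ (n : ℕ) (u : Fin n → A) (P : ι → NumPred) (x : Fin p → Fin n) (X : Fin q → Set (Fin n)),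
        (∃ i, f (encLetter u P x X i)) ↔ encode u P x X ∈ R := by
  refine ⟨_, Language.isRegular_existsLE f f, fun n u P x X => ?_⟩
  rw [encode, Language.ofFn_mem_existsLE]
  exact ⟨fun ⟨i, h⟩ => ⟨i, i, le_rfl, h, h⟩, fun ⟨i, _, _, h, _⟩ => ⟨i, h⟩⟩

/-- Every MSO formula defines a regular language of encodings. -/
theorem MSO.exists_regular {A ι : Type*} {p q : ℕ} (φ : MSO A ι p q) :
    ∃ R : Language (EncLetter A ι p q), R.IsRegular ∧
      ∀ (n : ℕ) (u : Fin n → A) (P : ι → NumPred) (x : Fin p → Fin n) (X : Fin q → Set (Fin n)),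
        φ.Sat u P x X ↔ encode u P x X ∈ R := by
  induction φ with
  | letter a y =>
    obtain ⟨R, hR, h⟩ := exists_regular_of_local (fun c : EncLetter A ι _ _ => y ∈ c.2.2.1 ∧ c.1 = a)
    refine ⟨R, hR, fun n u P x X => ?_⟩
    rw [← h]
    simp [MSO.Sat, encLetter]
  | le y z =>
    refine ⟨_, Language.isRegular_existsLE (fun c : EncLetter A ι _ _ => y ∈ c.2.2.1)
      (fun c => z ∈ c.2.2.1), fun n u P x X => ?_⟩
    rw [encode, Language.ofFn_mem_existsLE]
    simp [MSO.Sat, encLetter]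
  | mem y Y =>
    obtain ⟨R, hR, h⟩ := exists_regular_of_local
      (fun c : EncLetter A ι _ _ => y ∈ c.2.2.1 ∧ Y ∈ c.2.2.2)
    refine ⟨R, hR, fun n u P x X => ?_⟩
    rw [← h]
    simp [MSO.Sat, encLetter]
  | pred s y =>
    obtain ⟨R, hR, h⟩ := exists_regular_of_local
      (fun c : EncLetter A ι _ _ => y ∈ c.2.2.1 ∧ s ∈ c.2.1)
    refine ⟨R, hR, fun n u P x X => ?_⟩
    rw [← h]
    simp [MSO.Sat, encLetter]
  | and φ ψ ih₁ ih₂ =>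
    obtain ⟨R₁, hR₁, h₁⟩ := ih₁
    obtain ⟨R₂, hR₂, h₂⟩ := ih₂
    exact ⟨R₁ ⊓ R₂, hR₁.inf hR₂, fun n u P x X => and_congr (h₁ n u P x X) (h₂ n u P x X)⟩
  | not φ ih =>
    obtain ⟨R, hR, h⟩ := ih
    exact ⟨Rᶜ, hR.compl, fun n u P x X => not_congr (h n u P x X)⟩
  | @existsPos p q φ ih =>
    obtain ⟨R, hR, h⟩ := ih
    let m : EncLetter A ι (p + 1) q → Prop := fun c => 0 ∈ c.2.2.1
    let f : EncLetter A ι (p + 1) q → EncLetter A ι p q :=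
      fun c => (c.1, c.2.1, Fin.succ ⁻¹' c.2.2.1, c.2.2.2)
    -- Erasing the track of `x_0` is the projection. A track encodes a position only if it is marked
    -- exactly once: at least once by `existsLE m m`, at most once by the complement of `existsLT
    -- m`.
    refine ⟨_, ((hR.inf (Language.isRegular_existsLE m m)).inf
      (Language.isRegular_existsLT m).compl).image_map f, fun n u P x X => ?_⟩
    have hmap : ∀ i, (encode u P (Fin.cons i x : Fin (p + 1) → Fin n) X).map f =
        encode u P x X := by
      intro i
      rw [encode, encode, List.map_ofFn]
      congr 1
    constructor
    · rintro ⟨i, hi⟩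
      refine ⟨encode u P (Fin.cons i x : Fin (p + 1) → Fin n) X, ⟨⟨(h ..).1 hi, ?_⟩, ?_⟩, hmap i⟩
      · exact Language.ofFn_mem_existsLE.2 ⟨i, i, le_rfl, rfl, rfl⟩
      · refine fun hlt => ?_
        obtain ⟨j, k, hjk, hj, hk⟩ := Language.ofFn_mem_existsLT.1 hlt
        exact hjk.ne (Eq.trans (Eq.symm hj) hk)
    · rintro ⟨v, ⟨⟨hv, i, _, _, hi, _⟩, hlt⟩, hvm⟩
      have hlen : v.length = n := by
        have := congrArg List.length hvm
        simpa [encode] using this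
      subst hlen
      have hget : ∀ j : Fin v.length, f v[j] = encLetter u P x X j := by
        intro j
        have : (v.map f)[(j : ℕ)]'(by simp) = (encode u P x X)[(j : ℕ)]'(by simp [encode]) := by
          simp only [hvm]
        simpa [encode] using this
      refine ⟨i, (h ..).2 ?_⟩
      -- All tracks of `v` but the erased one agree with the encoding by `hget`; the erased one is
      -- settled by uniqueness of the mark.
      suffices encode u P (Fin.cons i x : Fin (p + 1) → Fin v.length) X = v by rwa [this]
      refine List.ext_getElem (by simp [encode]) fun j hj hj' => ?_
      have hg := hget ⟨j, hj'⟩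
      simp only [encode, List.getElem_ofFn]
      simp only [f, encLetter, Prod.mk.injEq, Fin.getElem_fin] at hg ⊢
      refine Prod.ext hg.1.symm (Prod.ext hg.2.1.symm (Prod.ext ?_ hg.2.2.2.symm))
      ext y
      refine Fin.cases ?_ (fun y => ?_) y
      · constructor
        · intro hij
          have hij : i = ⟨j, hj'⟩ := hij
          subst hij
          exact hi
        · intro hj0
          by_contra hne
          have hne : i ≠ ⟨j, hj'⟩ := hne
          rcases lt_or_gt_of_ne hne with hl | hl
          · exact hlt ⟨i, ⟨j, hj'⟩, hl, hi, hj0⟩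
          · exact hlt ⟨⟨j, hj'⟩, i, hl, hj0, hi⟩
      · exact (Set.ext_iff.1 hg.2.2.1 y).symm
  | @existsSet p q φ ih =>
    obtain ⟨R, hR, h⟩ := ih
    let f : EncLetter A ι p (q + 1) → EncLetter A ι p q :=
      fun c => (c.1, c.2.1, c.2.2.1, Fin.succ ⁻¹' c.2.2.2)
    refine ⟨_, hR.image_map f, fun n u P x X => ?_⟩
    have hmap : ∀ S, (encode u P x (Fin.cons S X : Fin (q + 1) → Set (Fin n))).map f =
        encode u P x X := by
      intro i
      rw [encode, encode, List.map_ofFn]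
      congr 1
    constructor
    · rintro ⟨S, hS⟩
      exact ⟨_, (h ..).1 hS, hmap S⟩
    · rintro ⟨v, hv, hvm⟩
      have hlen : v.length = n := by
        have := congrArg List.length hvm
        simpa [encode] using this
      subst hlen
      have hget : ∀ j : Fin v.length, f v[j] = encLetter u P x X j := by
        intro j
        have : (v.map f)[(j : ℕ)]'(by simp) = (encode u P x X)[(j : ℕ)]'(by simp [encode]) := by
          simp only [hvm]
        simpa [encode] using this
      -- The witness is read off the erased track; unlike for positions, every track encodes a set.
      refine ⟨{j | 0 ∈ v[j].2.2.2}, (h ..).2 ?_⟩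
      suffices encode u P x (Fin.cons {j | 0 ∈ v[j].2.2.2} X :
        Fin (q + 1) → Set (Fin v.length)) = v by rwa [this]
      refine List.ext_getElem (by simp [encode]) fun j hj hj' => ?_
      have hg := hget ⟨j, hj'⟩
      simp only [encode, List.getElem_ofFn]
      simp only [f, encLetter, Prod.mk.injEq, Fin.getElem_fin] at hg ⊢
      refine Prod.ext hg.1.symm (Prod.ext hg.2.1.symm (Prod.ext hg.2.2.1.symm ?_))
      ext y
      refine Fin.cases ?_ (fun y => ?_) y
      · exact Iff.rfl
      · exact (Set.ext_iff.1 hg.2.2.2 y).symm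

/-! ### Renaming, interpretation and elimination of definable predicates -/

namespace MSO

/-- Renaming of the free variables. -/
def rename {A ι : Type*} : {p q p' q' : ℕ} → (Fin p → Fin p') → (Fin q → Fin q') →
    MSO A ι p q → MSO A ι p' q'
  | _, _, _, _, f, _, .letter a y => .letter a (f y)
  | _, _, _, _, f, _, .le y z => .le (f y) (f z)
  | _, _, _, _, f, g, .mem y Y => .mem (f y) (g Y)
  | _, _, _, _, f, _, .pred s y => .pred s (f y)
  | _, _, _, _, f, g, .and φ ψ => .and (φ.rename f g) (ψ.rename f g)
  | _, _, _, _, f, g, .not φ => .not (φ.rename f g)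
  | _, _, _, _, f, g, .existsPos φ => .existsPos (φ.rename (Fin.cons 0 (Fin.succ ∘ f)) g)
  | _, _, _, _, f, g, .existsSet φ => .existsSet (φ.rename f (Fin.cons 0 (Fin.succ ∘ g)))

theorem cons_comp_cons_succ {α : Type*} {p p' : ℕ} (f : Fin p → Fin p') (i : α)
    (x : Fin p' → α) :
    (Fin.cons i x : Fin (p' + 1) → α) ∘ (Fin.cons 0 (Fin.succ ∘ f) : Fin (p + 1) → Fin (p' + 1)) =
      (Fin.cons i (x ∘ f) : Fin (p + 1) → α) := by
  funext y
  refine Fin.cases ?_ (fun y => ?_) y <;> simp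

theorem sat_rename {A ι : Type*} {n : ℕ} (u : Fin n → A) (P : ι → NumPred) {p q : ℕ}
    (φ : MSO A ι p q) : ∀ {p' q' : ℕ} (f : Fin p → Fin p') (g : Fin q → Fin q')
      (x : Fin p' → Fin n) (X : Fin q' → Set (Fin n)),
      (φ.rename f g).Sat u P x X ↔ φ.Sat u P (x ∘ f) (X ∘ g) := by
  induction φ with
  | letter a y => intros; rfl
  | le y z => intros; rfl
  | mem y Y => intros; rfl
  | pred s y => intros; rfl
  | and φ ψ ih₁ ih₂ => intros; exact and_congr (ih₁ ..) (ih₂ ..)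
  | not φ ih => intros; exact not_congr (ih ..)
  | existsPos φ ih =>
    intros
    refine exists_congr fun i => ?_
    rw [ih, cons_comp_cons_succ]
  | existsSet φ ih =>
    intros
    refine exists_congr fun i => ?_
    rw [ih, cons_comp_cons_succ]

/-- A formula that holds everywhere. -/
def verum {A ι : Type*} {p q : ℕ} : MSO A ι p q :=
  -- An instance of excluded middle: `existsPos (le 0 0)` alone fails in the empty word.
  .not (.and (.existsPos (.le 0 0)) (.not (.existsPos (.le 0 0))))

@[simp] theorem sat_verum {A ι : Type*} {n p q : ℕ} (u : Fin n → A) (P : ι → NumPred)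
    (x : Fin p → Fin n) (X : Fin q → Set (Fin n)) : (verum : MSO A ι p q).Sat u P x X := by
  simp [verum, Sat]

/-- Interpretation of a formula over another alphabet and other predicate symbols, given
interpretations of the letters and of the predicate symbols. -/
def interpret {A ι A' ι' : Type*} (l : A → MSO A' ι' 1 0) (t : ι → MSO A' ι' 1 0) :
    {p q : ℕ} → MSO A ι p q → MSO A' ι' p q
  | _, _, .letter a y => (l a).rename (fun _ => y) Fin.elim0
  | _, _, .le y z => .le y z
  | _, _, .mem y Y => .mem y Y
  | _, _, .pred s y => (t s).rename (fun _ => y) Fin.elim0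
  | _, _, .and φ ψ => .and (φ.interpret l t) (ψ.interpret l t)
  | _, _, .not φ => .not (φ.interpret l t)
  | _, _, .existsPos φ => .existsPos (φ.interpret l t)
  | _, _, .existsSet φ => .existsSet (φ.interpret l t)

theorem sat_interpret {A ι A' ι' : Type*} {l : A → MSO A' ι' 1 0} {t : ι → MSO A' ι' 1 0} {n : ℕ}
    {u : Fin n → A} {P : ι → NumPred} {u' : Fin n → A'} {P' : ι' → NumPred}
    (hl : ∀ a i, (l a).Sat u' P' (fun _ => i) Fin.elim0 ↔ u i = a)
    (ht : ∀ s i, (t s).Sat u' P' (fun _ => i) Fin.elim0 ↔ i ∈ P s n) {p q : ℕ}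
    (φ : MSO A ι p q) : ∀ (x : Fin p → Fin n) (X : Fin q → Set (Fin n)),
      (φ.interpret l t).Sat u' P' x X ↔ φ.Sat u P x X := by
  have hE : ∀ {q : ℕ} (X : Fin q → Set (Fin n)), X ∘ Fin.elim0 = Fin.elim0 :=
    fun X => Subsingleton.elim _ _
  induction φ with
  | letter a y =>
    intro x X
    rw [interpret, sat_rename, hE]
    exact hl a (x y)
  | le y z => intros; rfl
  | mem y Y => intros; rfl
  | pred s y =>
    intro x X
    rw [interpret, sat_rename, hE]
    exact ht s (x y)
  | and φ ψ ih₁ ih₂ => intros; exact and_congr (ih₁ ..) (ih₂ ..)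
  | not φ ih => intros; exact not_congr (ih ..)
  | existsPos φ ih => intros; exact exists_congr fun i => ih ..
  | existsSet φ ih => intros; exact exists_congr fun i => ih ..

end MSO

/-- Definability is transitive: definable predicates can be eliminated. -/
theorem LanguageDefinable.trans {A ι ι' : Type*} {P : ι → NumPred} {P' : ι' → NumPred}
    {L : Language A} (hL : LanguageDefinable P L) (hP : ∀ s, PredicateDefinable P' (P s)) :
    LanguageDefinable P' L := by
  obtain ⟨φ, rfl⟩ := hL
  choose t ht using hP
  -- The defining formulae `t s` live over the one-letter alphabet, where a letter test is always
  -- true; it is therefore replaced by `verum` before the formula is used over `A`.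
  refine ⟨φ.interpret (fun a => .letter a 0)
    (fun s => (t s).interpret (fun _ => MSO.verum) fun s' => .pred s' 0), ?_⟩
  ext w
  refine MSO.sat_interpret (fun _ _ => Iff.rfl) (fun s i => ?_) φ _ _
  rw [MSO.sat_interpret (u := fun _ => ()) (P := P') (fun _ _ => ?_) (fun _ _ => Iff.rfl), ht]
  · rfl
  · simp

/-! ### From automata to formulae -/

namespace MSO

variable {A ι : Type*} {p q : ℕ}

/-- Disjunction. -/
def or (φ ψ : MSO A ι p q) : MSO A ι p q := .not (.and (.not φ) (.not ψ))

/-- Equivalence. -/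
def iff (φ ψ : MSO A ι p q) : MSO A ι p q := .and (.not (.and φ (.not ψ))) (.not (.and ψ (.not φ)))

/-- Universal quantification over positions. -/
def allPos (φ : MSO A ι (p + 1) q) : MSO A ι p q := .not (.existsPos (.not φ))

/-- The formula `x_y < x_z`. -/
def lt (y z : Fin p) : MSO A ι p q := .not (.le z y)

open Classical in
/-- A truth value as a formula. -/
noncomputable def const (c : Prop) : MSO A ι p q := if c then verum else .not verum

/-- Finite disjunction. -/
noncomputable def iOr {κ : Type*} [Finite κ] (φ : κ → MSO A ι p q) : MSO A ι p q :=
  ((Set.finite_univ (α := κ)).toFinset.toList.map φ).foldr or (.not verum)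

/-- Finite conjunction. -/
noncomputable def iAnd {κ : Type*} [Finite κ] (φ : κ → MSO A ι p q) : MSO A ι p q :=
  .not (iOr fun k => .not (φ k))

variable {n : ℕ} (u : Fin n → A) (P : ι → NumPred) (x : Fin p → Fin n) (X : Fin q → Set (Fin n))

@[simp] theorem sat_or (φ ψ : MSO A ι p q) :
    (or φ ψ).Sat u P x X ↔ φ.Sat u P x X ∨ ψ.Sat u P x X := by
  simp only [or, Sat]; tauto

@[simp] theorem sat_iff (φ ψ : MSO A ι p q) :
    (iff φ ψ).Sat u P x X ↔ (φ.Sat u P x X ↔ ψ.Sat u P x X) := by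
  simp only [iff, Sat]; tauto

@[simp] theorem sat_allPos (φ : MSO A ι (p + 1) q) :
    (allPos φ).Sat u P x X ↔ ∀ i, φ.Sat u P (Fin.cons i x) X := by
  simp [allPos, Sat]

@[simp] theorem sat_lt (y z : Fin p) : (lt y z : MSO A ι p q).Sat u P x X ↔ x y < x z := by
  simp [lt, Sat]

@[simp] theorem sat_const (c : Prop) : (const c : MSO A ι p q).Sat u P x X ↔ c := by
  unfold const; split_ifs with h <;> simp [Sat, h]

@[simp] theorem sat_iOr {κ : Type*} [Finite κ] (φ : κ → MSO A ι p q) :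
    (iOr φ).Sat u P x X ↔ ∃ k, (φ k).Sat u P x X := by
  have : ∀ l : List κ, ((l.map φ).foldr or (.not verum)).Sat u P x X ↔
      ∃ k ∈ l, (φ k).Sat u P x X := by
    intro l
    induction l with
    | nil => simp [Sat]
    | cons k l ih => simp [ih]
  simp [iOr, this]

@[simp] theorem sat_iAnd {κ : Type*} [Finite κ] (φ : κ → MSO A ι p q) :
    (iAnd φ).Sat u P x X ↔ ∀ k, (φ k).Sat u P x X := by
  simp [iAnd, Sat]

/-- The formula saying that the position `x_z` is the first one. -/
def isFirst (z : Fin p) : MSO A ι p q := .not (.existsPos (lt 0 z.succ))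

@[simp] theorem sat_isFirst (z : Fin p) :
    (isFirst z : MSO A ι p q).Sat u P x X ↔ (x z : ℕ) = 0 := by
  simp only [isFirst, Sat, sat_lt, Fin.cons_zero, Fin.cons_succ, not_exists, not_lt]
  constructor
  · intro h
    have := Fin.le_def.1 (h ⟨0, (x z).pos⟩)
    simpa using this
  · intro h i
    rw [Fin.le_def]
    lia

/-- The formula saying that the position `x_z` is the last one. -/
def isLast (z : Fin p) : MSO A ι p q := .not (.existsPos (lt z.succ 0))

@[simp] theorem sat_isLast (z : Fin p) :
    (isLast z : MSO A ι p q).Sat u P x X ↔ (x z : ℕ) + 1 = n := by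
  simp only [isLast, Sat, sat_lt, Fin.cons_zero, Fin.cons_succ, not_exists, not_lt]
  have hz := (x z).isLt
  constructor
  · intro h
    have := Fin.le_def.1 (h ⟨n - 1, by lia⟩)
    simp only at this
    lia
  · intro h i
    rw [Fin.le_def]
    lia

/-- The formula saying that the position `x_z` is the successor of `x_y`. -/
def isSucc (y z : Fin p) : MSO A ι p q :=
  .and (lt y z) (.not (.existsPos (.and (lt y.succ 0) (lt 0 z.succ))))

@[simp] theorem sat_isSucc (y z : Fin p) :
    (isSucc y z : MSO A ι p q).Sat u P x X ↔ (x y : ℕ) + 1 = x z := by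
  simp only [isSucc, Sat, sat_lt, Fin.cons_zero, Fin.cons_succ, not_exists, not_and, not_lt]
  have hz := (x z).isLt
  constructor
  · rintro ⟨h, h'⟩
    have := h' ⟨x y + 1, by rw [Fin.lt_def] at h; lia⟩ (by rw [Fin.lt_def]; simp)
    rw [Fin.lt_def] at h
    rw [Fin.le_def] at this
    simp only at this
    lia
  · intro h
    refine ⟨by rw [Fin.lt_def]; lia, fun i hi => ?_⟩
    rw [Fin.lt_def] at hi
    rw [Fin.le_def]
    lia

/-- The formula saying that the letter of the encoding at position `x_z` is `c`, where the
encoded valuation consists of the variables given by `f` and `g`. -/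
noncomputable def hasLetter [Finite ι] {p₀ q₀ : ℕ} (f : Fin p₀ → Fin p) (g : Fin q₀ → Fin q)
    (z : Fin p) (c : EncLetter A ι p₀ q₀) : MSO A ι p q :=
  .and (.letter c.1 z) (.and (iAnd fun s => iff (.pred s z) (const (s ∈ c.2.1)))
    (.and (iAnd fun y => iff (.and (.le (f y) z) (.le z (f y))) (const (y ∈ c.2.2.1)))
      (iAnd fun Y => iff (.mem z (g Y)) (const (Y ∈ c.2.2.2)))))

@[simp] theorem sat_hasLetter [Finite ι] {p₀ q₀ : ℕ} (f : Fin p₀ → Fin p) (g : Fin q₀ → Fin q)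
    (z : Fin p) (c : EncLetter A ι p₀ q₀) :
    (hasLetter f g z c).Sat u P x X ↔ encLetter u P (x ∘ f) (X ∘ g) (x z) = c := by
  obtain ⟨a, S, Y, Z⟩ := c
  simp [hasLetter, Sat, encLetter, Set.ext_iff, ← le_antisymm_iff]

/-- Each quantifier binds index `0` and shifts the rest, so a block of `m` set quantifiers binds the
indices below `m` and the old variable `i` becomes `i.addNat m`. -/
theorem exists_existsSets (m : ℕ) (φ : MSO A ι p (q + m)) :
    ∃ ψ : MSO A ι p q, ∀ (n : ℕ) (u : Fin n → A) (P : ι → NumPred) (x : Fin p → Fin n)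
      (X : Fin q → Set (Fin n)), ψ.Sat u P x X ↔
        ∃ Y : Fin (q + m) → Set (Fin n), (Y ∘ fun i => i.addNat m) = X ∧ φ.Sat u P x Y := by
  induction m with
  | zero =>
    refine ⟨φ, fun n u P x X => ?_⟩
    constructor
    · exact fun h => ⟨X, rfl, h⟩
    · rintro ⟨Y, rfl, h⟩
      exact h
  | succ m ih =>
    obtain ⟨ψ, hψ⟩ := ih (.existsSet φ)
    refine ⟨ψ, fun n u P x X => ?_⟩
    rw [hψ]
    constructor
    · rintro ⟨Y, rfl, S, h⟩
      exact ⟨(Fin.cons S Y : Fin (q + m + 1) → Set (Fin n)), rfl, h⟩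
    · rintro ⟨Y, rfl, h⟩
      refine ⟨fun i => Y i.succ, rfl, Y 0, ?_⟩
      rwa [show (Fin.cons (Y 0) fun i => Y i.succ : Fin (q + m + 1) → Set (Fin n)) = Y from
        Fin.cons_self_tail Y]

/-- The body of `isRun`. -/
noncomputable def isRunAt [Finite A] [Finite ι] {σ : Type*} [Finite σ]
    (M : DFA (EncLetter A ι p q) σ) {q' : ℕ} (g : Fin q → Fin q') (v : σ → Fin q') (s : σ) :
    MSO A ι (p + 1) q' :=
  iff (.mem 0 (v s))
    (or (.and (isFirst 0) (iOr fun c => .and (hasLetter Fin.succ g 0 c)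
          (const (M.step M.start c = s))))
      (.existsPos (.and (isSucc 0 1) (iOr fun t => .and (.mem 0 (v t))
        (iOr fun c => .and (hasLetter (fun y => y.succ.succ) g 1 c)
          (const (M.step t c = s)))))))

/-- The formula saying that the set variable `v s` is the set of the positions after which the
automaton `M` is in the state `s`. -/
noncomputable def isRun [Finite A] [Finite ι] {σ : Type*} [Finite σ]
    (M : DFA (EncLetter A ι p q) σ) {q' : ℕ} (g : Fin q → Fin q') (v : σ → Fin q') :
    MSO A ι p q' :=
  allPos (iAnd fun s => isRunAt M g v s)

/-- The condition in `isRun` is local, relating a position only to its predecessor. Since `M` is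
deterministic, induction on the position shows that the actual run is its only solution. -/
theorem sat_isRun [Finite A] [Finite ι] {σ : Type*} [Finite σ]
    (M : DFA (EncLetter A ι p q) σ) {q' : ℕ} (g : Fin q → Fin q') (v : σ → Fin q')
    (Y : Fin q' → Set (Fin n)) :
    (isRun M g v).Sat u P x Y ↔
      ∀ s, Y (v s) = {i : Fin n | M.eval ((encode u P x (Y ∘ g)).take (i + 1)) = s} := by
  have htake : ∀ i : Fin n, M.eval ((encode u P x (Y ∘ g)).take (i + 1)) =
      M.step (M.eval ((encode u P x (Y ∘ g)).take i)) (encLetter u P x (Y ∘ g) i) := by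
    intro i
    have hi : (i : ℕ) < (encode u P x (Y ∘ g)).length := by simp [encode]
    rw [← List.take_append_getElem hi, DFA.eval_append_singleton]
    simp [encode]
  have h1 : (isRun M g v).Sat u P x Y ↔ ∀ (i : Fin n) (s : σ), i ∈ Y (v s) ↔
      ((i : ℕ) = 0 ∧ M.step M.start (encLetter u P x (Y ∘ g) i) = s) ∨
      ∃ j : Fin n, (j : ℕ) + 1 = i ∧ ∃ t, j ∈ Y (v t) ∧
        M.step t (encLetter u P x (Y ∘ g) i) = s := by
    simp only [isRun, isRunAt, sat_allPos, sat_iAnd, sat_iff, sat_or, Sat, sat_isFirst, sat_iOr,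
      sat_hasLetter, sat_const, sat_isSucc, Fin.cons_zero, Fin.cons_one, exists_eq_left']
    rfl
  rw [h1]
  constructor
  · intro h
    have key : ∀ (k : ℕ) (hk : k < n) (s : σ), (⟨k, hk⟩ : Fin n) ∈ Y (v s) ↔
        M.eval ((encode u P x (Y ∘ g)).take (k + 1)) = s := by
      intro k
      induction k with
      | zero =>
        intro hk s
        rw [h, htake ⟨0, hk⟩]
        simp
      | succ k ih =>
        intro hk s
        rw [h, htake ⟨k + 1, hk⟩]
        constructor
        · rintro (⟨h0, _⟩ | ⟨j, hj, t, ht, rfl⟩)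
          · simp at h0
          · obtain rfl : j = ⟨k, by lia⟩ := by
              ext
              simpa using hj
            rw [ih] at ht
            rw [← ht]
        · rintro rfl
          exact Or.inr ⟨⟨k, by lia⟩, rfl, _, (ih _ _).2 rfl, rfl⟩
    intro s
    ext i
    exact key i i.2 s
  · intro h i s
    rw [h]
    simp only [h, Set.mem_ofPred_eq]
    rw [htake]
    constructor
    · rintro rfl
      rcases Nat.eq_zero_or_pos (i : ℕ) with h0 | h0
      · exact Or.inl ⟨h0, by simp [h0]⟩
      · refine Or.inr ⟨⟨i - 1, by lia⟩, by simp; lia, _, rfl, ?_⟩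
        simp only
        rw [show (i : ℕ) - 1 + 1 = i by lia]
    · rintro (⟨h0, rfl⟩ | ⟨j, hj, t, rfl, rfl⟩)
      · simp [h0]
      · rw [hj]

/-- Every regular language of encodings is defined by an MSO formula. -/
theorem exists_formula_of_isRegular [Finite A] [Finite ι]
    {R : Language (EncLetter A ι p q)} (hR : R.IsRegular) :
    ∃ φ : MSO A ι p q, ∀ (n : ℕ) (u : Fin n → A) (P : ι → NumPred) (x : Fin p → Fin n)
      (X : Fin q → Set (Fin n)), φ.Sat u P x X ↔ encode u P x X ∈ R := by
  obtain ⟨σ, _, M, rfl⟩ := hR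
  let e := Fintype.equivFin σ
  let m := Fintype.card σ
  let g : Fin q → Fin (q + m) := fun i => i.addNat m
  -- The guessed sets occupy the indices below `m`, one per state, and `g` moves the original set
  -- variables past them.
  let v : σ → Fin (q + m) := fun s => ⟨e s, by have := (e s).2; lia⟩
  obtain ⟨φ, hφ⟩ := exists_existsSets m (.and (isRun M g v)
    -- The empty word has no last position from which to read the final state, hence the separate
    -- disjunct.
    (or (.and (.not (.existsPos (.le 0 0))) (const (M.start ∈ M.accept)))
      (.existsPos (.and (isLast 0) (iOr fun s => .and (const (s ∈ M.accept)) (.mem 0 (v s))))) :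
        MSO A ι p (q + m)))
  refine ⟨φ, fun n u P x X => ?_⟩
  have hlen : (encode u P x X).length = n := by simp [encode]
  rw [hφ, DFA.mem_accepts]
  have hacc : ∀ Y : Fin (q + m) → Set (Fin n), Y ∘ g = X →
      (Sat u P (isRun M g v) x Y) →
      ((or (.and (.not (.existsPos (.le 0 0))) (const (M.start ∈ M.accept)))
      (.existsPos (.and (isLast 0) (iOr fun s => .and (const (s ∈ M.accept)) (.mem 0 (v s))))) :
        MSO A ι p (q + m)).Sat u P x Y ↔ M.eval (encode u P x X) ∈ M.accept) := by
    rintro Y rfl hY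
    rw [sat_isRun] at hY
    simp only [sat_or, Sat, sat_const, le_refl, sat_isLast, sat_iOr, Fin.cons_zero, hY,
      Set.mem_ofPred_eq, exists_eq_right']
    rcases Nat.eq_zero_or_pos n with rfl | hn
    · simp [encode]
    · have : Nonempty (Fin n) := ⟨⟨0, hn⟩⟩
      simp only [exists_const, not_true_eq_false, false_and, false_or]
      constructor
      · rintro ⟨i, hi, h⟩
        rwa [List.take_of_length_le (by lia)] at h
      · intro h
        refine ⟨⟨n - 1, by lia⟩, by simp; lia, ?_⟩
        rwa [List.take_of_length_le (by simp only; lia)]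
  constructor
  · rintro ⟨Y, hYX, hrun, h⟩
    exact (hacc Y hYX hrun).1 h
  · intro h
    let Y : Fin (q + m) → Set (Fin n) := fun k =>
      if hk : (k : ℕ) < m then
        {i : Fin n | M.eval ((encode u P x X).take (i + 1)) = e.symm ⟨k, hk⟩}
      else X ⟨k - m, by have := k.2; lia⟩
    have hYX : Y ∘ g = X := by
      funext i
      simp [Y, g]
    have hrun : (isRun M g v).Sat u P x Y := by
      rw [sat_isRun, hYX]
      intro s
      simp only [Y, v, m, Fin.eta, Equiv.symm_apply_apply, (e s).2, dif_pos]
    exact ⟨Y, hYX, hrun, (hacc Y hYX hrun).2 h⟩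

end MSO

/-! ### Automata with advice -/

/-- The word of truth values of the predicates on the positions `0, …, n - 1`. -/
def advice {ι : Type*} (P : ι → NumPred) (n : ℕ) : List (Set ι) :=
  List.ofFn fun j : Fin n => {s | j ∈ P s n}

@[simp] theorem length_advice {ι : Type*} (P : ι → NumPred) (n : ℕ) : (advice P n).length = n := by
  simp [advice]

theorem getElem_advice {ι : Type*} (P : ι → NumPred) {n i : ℕ} (h : i < (advice P n).length) :
    (advice P n)[i] = {s | (⟨i, by simpa using h⟩ : Fin n) ∈ P s n} := by
  simp [advice]

/-- An automaton over `A × B` recognizes `L` with the advice words `b n`. -/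
def DFA.RecognizesWith {A B σ : Type*} (M : DFA (A × B) σ) (b : ℕ → List B) (L : Language A) :
    Prop :=
  ∀ w : List A, w ∈ L ↔ M.eval (w.zip (b w.length)) ∈ M.accept

theorem encode_eq_zip {A ι : Type*} (w : List A) (P : ι → NumPred)
    (x : Fin 0 → Fin w.length) (X : Fin 0 → Set (Fin w.length)) :
    encode w.get P x X = (w.zip (advice P w.length)).map fun c => (c.1, c.2, ∅, ∅) := by
  refine List.ext_getElem (by simp [encode]) fun j _ _ => ?_
  simp only [encode, List.getElem_ofFn, encLetter, List.getElem_map, List.getElem_zip,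
    getElem_advice]
  refine Prod.ext rfl (Prod.ext rfl (Prod.ext ?_ ?_)) <;> exact Subsingleton.elim _ _

/-- A language is definable in MSO with predicates `P` iff it is recognized by a finite automaton
that reads the truth values of the predicates as advice. -/
theorem languageDefinable_iff {A ι : Type*} [Finite A] [Finite ι] (P : ι → NumPred)
    (L : Language A) : LanguageDefinable P L ↔
      ∃ (σ : Type) (_ : Fintype σ) (M : DFA (A × Set ι) σ), M.RecognizesWith (advice P) L := by
  constructor
  · rintro ⟨φ, rfl⟩
    obtain ⟨R, ⟨σ, hσ, M, rfl⟩, hR⟩ := φ.exists_regular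
    refine ⟨σ, hσ, M.comap fun c => (c.1, c.2, ∅, ∅), fun w => ?_⟩
    rw [DFA.eval_comap]
    refine (hR _ w.get P Fin.elim0 Fin.elim0).trans ?_
    rw [encode_eq_zip]
    rfl
  · rintro ⟨σ, hσ, M, hM⟩
    obtain ⟨φ, hφ⟩ := MSO.exists_formula_of_isRegular (A := A) (ι := ι) (p := 0) (q := 0)
      ⟨σ, hσ, M.comap fun c : EncLetter A ι 0 0 => (c.1, c.2.1), rfl⟩
    refine ⟨φ, ?_⟩
    ext w
    refine (hφ _ w.get P Fin.elim0 Fin.elim0).trans ?_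
    rw [hM, DFA.accepts_comap, encode_eq_zip]
    change M.eval (List.map _ (List.map _ _)) ∈ M.accept ↔ _
    rw [List.map_map]
    simp [Function.comp_def]

/-- A language is regular iff it is definable in MSO without predicates. -/
theorem isRegular_iff_languageDefinable {A : Type*} [Finite A] (L : Language A) :
    L.IsRegular ↔ LanguageDefinable (Fin.elim0 : Fin 0 → NumPred) L := by
  rw [languageDefinable_iff]
  constructor
  · rintro ⟨σ, hσ, M, rfl⟩
    refine ⟨σ, hσ, M.comap Prod.fst, fun w => ?_⟩
    rw [DFA.eval_comap, List.map_fst_zip (by simp)]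
    rfl
  · rintro ⟨σ, hσ, M, hM⟩
    refine ⟨σ, hσ, M.comap fun a => (a, ∅), ?_⟩
    ext w
    rw [hM, DFA.accepts_comap]
    change M.eval (List.map _ w) ∈ M.accept ↔ _
    suffices w.map (fun a => (a, (∅ : Set (Fin 0)))) = w.zip (advice Fin.elim0 w.length) by rw [this]
    refine List.ext_getElem (by simp) fun j _ _ => ?_
    simp only [List.getElem_map, List.getElem_zip]
    exact Prod.ext rfl (Subsingleton.elim _ _)

/-- A predicate is definable if membership of a position in it is recognized by a finite automaton
that reads the advice word, marked at that position. -/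
theorem predicateDefinable_of_dfa {ι : Type*} [Finite ι] {P : ι → NumPred} {R : NumPred}
    {τ : Type} [Finite τ] (N : DFA (Set ι × Prop) τ)
    (hN : ∀ (n : ℕ) (i : Fin n), i ∈ R n ↔
      N.eval (List.ofFn fun j : Fin n => ({s | j ∈ P s n}, i = j)) ∈ N.accept) :
    PredicateDefinable P R := by
  have := Fintype.ofFinite τ
  obtain ⟨φ, hφ⟩ := MSO.exists_formula_of_isRegular (A := Unit) (ι := ι) (p := 1) (q := 0)
    -- The track of the only free variable plays the role of the mark.
    ⟨τ, inferInstance, N.comap fun c : EncLetter Unit ι 1 0 => (c.2.1, 0 ∈ c.2.2.1), rfl⟩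
  refine ⟨φ, fun n => ?_⟩
  ext i
  rw [hN]
  refine Iff.symm ((hφ _ _ P (fun _ => i) Fin.elim0).trans ?_)
  rw [DFA.accepts_comap]
  change N.eval (List.map _ _) ∈ N.accept ↔ _
  rw [encode, List.map_ofFn]
  rfl

/-! ### Finite data on states, updated along the advice -/

theorem List.append_singleton_lt_iff {A : Type*} [LinearOrder A] {u v : List A} {a b : A}
    (h : u.length = v.length) : u ++ [a] < v ++ [b] ↔ u < v ∨ (u = v ∧ a < b) := by
  induction u generalizing v with
  | nil =>
    obtain rfl : v = [] := List.length_eq_zero_iff.1 h.symm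
    simp [List.cons_lt_cons_iff]
  | cons c u ih =>
    cases v with
    | nil => simp at h
    | cons d v =>
      simp only [List.cons_append, List.cons_lt_cons_iff, List.cons.injEq,
        ih (Nat.succ_injective h)]
      tauto

theorem List.append_singleton_le_iff {A : Type*} [LinearOrder A] {u v : List A} {a b : A}
    (h : u.length = v.length) : u ++ [a] ≤ v ++ [b] ↔ u < v ∨ (u = v ∧ a ≤ b) := by
  rw [← not_lt, append_singleton_lt_iff h.symm]
  constructor
  · intro h'
    push Not at h'
    rcases h'.1.lt_or_eq with h'' | h''
    · exact Or.inl h''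
    · exact Or.inr ⟨h'', h'.2 h''.symm⟩
  · rintro (h' | ⟨rfl, h'⟩)
    · rintro (h'' | ⟨rfl, _⟩)
      · exact lt_asymm h' h''
      · exact lt_irrefl _ h'
    · rintro (h'' | ⟨_, h''⟩)
      · exact lt_irrefl _ h''
      · exact h''.not_ge h'

namespace DFA

variable {A B σ : Type*} (M : DFA (A × B) σ)

/-- The words that lead from the initial state to `s` along the advice word `c`. -/
def reaching (c : List B) (s : σ) : Set (List A) :=
  {u | u.length = c.length ∧ M.eval (u.zip c) = s}

theorem mem_reaching_eval {c : List B} {u : List A} (hu : u.length = c.length) :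
    u ∈ M.reaching c (M.eval (u.zip c)) := ⟨hu, rfl⟩

theorem eval_zip_append_singleton {c : List B} {u : List A} (hu : u.length = c.length) (a : A)
    (b : B) : M.eval ((u ++ [a]).zip (c ++ [b])) = M.step (M.eval (u.zip c)) (a, b) := by
  rw [List.zip_append hu]
  exact M.eval_append_singleton _ _

theorem append_singleton_mem_reaching {c : List B} {b : B} {u : List A} {a : A} {s : σ} :
    u ++ [a] ∈ M.reaching (c ++ [b]) s ↔ ∃ t, u ∈ M.reaching c t ∧ M.step t (a, b) = s := by
  simp only [reaching, Set.mem_ofPred_eq, List.length_append, List.length_singleton,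
    Nat.add_right_cancel_iff]
  constructor
  · rintro ⟨hu, rfl⟩
    exact ⟨_, ⟨hu, rfl⟩, (M.eval_zip_append_singleton hu a b).symm⟩
  · rintro ⟨t, ⟨hu, rfl⟩, rfl⟩
    exact ⟨hu, M.eval_zip_append_singleton hu a b⟩

theorem exists_of_mem_reaching_append_singleton {c : List B} {b : B} {u : List A} {s : σ}
    (hu : u ∈ M.reaching (c ++ [b]) s) : ∃ v a, u = v ++ [a] := by
  have hne : u ≠ [] := by
    rintro rfl
    simpa using hu.1
  exact ⟨_, _, (List.dropLast_append_getLast hne).symm⟩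

/-- States that cannot be distinguished by a word read along the advice word `d`. -/
def suffixEquiv (d : List B) (s t : σ) : Prop :=
  ∀ w : List A, w.length = d.length →
    (M.evalFrom s (w.zip d) ∈ M.accept ↔ M.evalFrom t (w.zip d) ∈ M.accept)

/-- The pairs of states reached from a pair of states by a common word along `d`. -/
def reachPairs (d : List B) (s t : σ) : Set (σ × σ) :=
  {x | ∃ w : List A, w.length = d.length ∧ (M.evalFrom s (w.zip d), M.evalFrom t (w.zip d)) = x}

/-- The indistinguishability relation given by a family of sets of reachable pairs. -/
def equivOfPairs (G : σ → σ → Set (σ × σ)) (s t : σ) : Prop :=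
  ∀ x ∈ G s t, x.1 ∈ M.accept ↔ x.2 ∈ M.accept

/-- `suffixEquiv` is naturally updated on the left, whereas an automaton reads the part after the
mark from left to right. The reachable pairs can be updated on the right and still determine the
relation. -/
theorem equivOfPairs_reachPairs (d : List B) :
    M.equivOfPairs (M.reachPairs d) = M.suffixEquiv d := by
  funext s t
  refine propext ⟨fun h w hw => h _ ⟨w, hw, rfl⟩, ?_⟩
  rintro h _ ⟨w, hw, rfl⟩
  exact h w hw

/-- Effect on an indistinguishability relation of one more letter on the left. -/
def consEquiv (E : σ → σ → Prop) (b : B) (s t : σ) : Prop :=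
  ∀ a, E (M.step s (a, b)) (M.step t (a, b))

theorem suffixEquiv_cons (b : B) (d : List B) :
    M.suffixEquiv (b :: d) = M.consEquiv (M.suffixEquiv d) b := by
  funext s t
  refine propext ⟨fun h a w hw => ?_, fun h w hw => ?_⟩
  · simpa using h (a :: w) (by simpa using hw)
  · cases w with
    | nil => simp at hw
    | cons a w => simpa using h a w (by simpa using hw)

/-- Effect on `reachPairs` of one more letter on the right. -/
def nextPairs (G : σ → σ → Set (σ × σ)) (b : B) (s t : σ) : Set (σ × σ) :=
  {x | ∃ y ∈ G s t, ∃ a, (M.step y.1 (a, b), M.step y.2 (a, b)) = x}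

theorem reachPairs_append_singleton (d : List B) (b : B) :
    M.reachPairs (d ++ [b]) = M.nextPairs (M.reachPairs d) b := by
  have hstep : ∀ (s : σ) (w : List A) (a : A), w.length = d.length →
      M.evalFrom s ((w ++ [a]).zip (d ++ [b])) = M.step (M.evalFrom s (w.zip d)) (a, b) := by
    intro s w a hw
    rw [List.zip_append hw]
    exact M.evalFrom_append_singleton _ _ _
  funext s t
  ext x
  constructor
  · rintro ⟨w, hw, rfl⟩
    have hne : w ≠ [] := by
      rintro rfl
      simp at hw
    obtain ⟨v, a, rfl⟩ : ∃ v a, w = v ++ [a] := ⟨_, _, (List.dropLast_append_getLast hne).symm⟩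
    have hv : v.length = d.length := by simpa using hw
    exact ⟨_, ⟨v, hv, rfl⟩, a, by simp only [hstep _ _ _ hv]⟩
  · rintro ⟨_, ⟨w, hw, rfl⟩, a, rfl⟩
    exact ⟨w ++ [a], by simpa using hw, by simp only [hstep _ _ _ hw]⟩

variable [LinearOrder A]

/-- The comparison of the lexicographically least words that reach the states; a state is
reachable iff it is related to itself. -/
def reachLE (c : List B) (s t : σ) : Prop :=
  ∃ u ∈ M.reaching c s, ∀ v ∈ M.reaching c t, u ≤ v

theorem exists_isLeast_reaching [Finite A] {c : List B} {s : σ} (h : (M.reaching c s).Nonempty) :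
    ∃ u, IsLeast (M.reaching c s) u := by
  have hfin : (M.reaching c s).Finite :=
    (List.finite_length_eq A c.length).subset fun u hu => hu.1
  obtain ⟨u, hu, hmin⟩ := hfin.exists_minimalFor id _ h
  exact ⟨u, hu, fun v hv => (le_total u v).elim id fun hvu => hmin hv hvu⟩

theorem reachLE_self_iff [Finite A] {c : List B} {s : σ} :
    M.reachLE c s s ↔ (M.reaching c s).Nonempty := by
  constructor
  · rintro ⟨u, hu, _⟩
    exact ⟨u, hu⟩
  · intro h
    obtain ⟨u, hu⟩ := M.exists_isLeast_reaching h
    exact ⟨u, hu.1, hu.2⟩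

theorem reachLE_iff_le {c : List B} {s t : σ} {u v : List A} (hu : IsLeast (M.reaching c s) u)
    (hv : IsLeast (M.reaching c t) v) : M.reachLE c s t ↔ u ≤ v := by
  constructor
  · rintro ⟨u', hu', h⟩
    exact (hu.2 hu').trans (h v hv.1)
  · exact fun h => ⟨u, hu.1, fun v' hv' => h.trans (hv.2 hv')⟩

/-- Effect on `reachLE` of one more letter on the right. -/
def nextLE (J : σ → σ → Prop) (b : B) (s' t' : σ) : Prop :=
  ∃ s a, J s s ∧ M.step s (a, b) = s' ∧ ∀ t a', J t t → M.step t (a', b) = t' →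
    (s = t ∧ a ≤ a') ∨ (s ≠ t ∧ J s t)

/-- Words of equal length ending in `a` and `a'` compare by their prefixes first, then by the last
letters. As `M` is deterministic, least words of distinct states differ, so the old comparison
together with equality of states decides everything. The guards `J t t` discard unreachable states,
to which every reachable state is vacuously related. -/
theorem reachLE_append_singleton [Finite A] (c : List B) (b : B) :
    M.reachLE (c ++ [b]) = M.nextLE (M.reachLE c) b := by
  funext s' t'
  refine propext ⟨?_, ?_⟩
  · rintro ⟨u', hu', h⟩
    obtain ⟨u, a, rfl⟩ := M.exists_of_mem_reaching_append_singleton hu'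
    obtain ⟨s, hu, hs⟩ := M.append_singleton_mem_reaching.1 hu'
    refine ⟨s, a, M.reachLE_self_iff.2 ⟨u, hu⟩, hs, fun t a' ht hta => ?_⟩
    obtain ⟨v, hv⟩ := M.exists_isLeast_reaching (M.reachLE_self_iff.1 ht)
    have hle := h _ (M.append_singleton_mem_reaching.2 ⟨t, hv.1, hta⟩)
    rw [List.append_singleton_le_iff (hu.1.trans hv.1.1.symm)] at hle
    by_cases hst : s = t
    · subst hst
      -- The prefix `u` cannot lie strictly below the least word `v` of the same state, so the last
      -- letters decide.
      exact Or.inl ⟨rfl, hle.elim (fun h' => absurd (hv.2 hu) h'.not_ge) fun h' => h'.2⟩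
    · refine Or.inr ⟨hst, u, hu, fun v' hv' => le_trans ?_ (hv.2 hv')⟩
      exact hle.elim le_of_lt fun h' => h'.1.le
  · rintro ⟨s, a, hs, hsa, h⟩
    obtain ⟨u, hu⟩ := M.exists_isLeast_reaching (M.reachLE_self_iff.1 hs)
    refine ⟨u ++ [a], M.append_singleton_mem_reaching.2 ⟨s, hu.1, hsa⟩, fun v' hv' => ?_⟩
    obtain ⟨v, a', rfl⟩ := M.exists_of_mem_reaching_append_singleton hv'
    obtain ⟨t, hv, ht⟩ := M.append_singleton_mem_reaching.1 hv'
    rw [List.append_singleton_le_iff (hu.1.1.trans hv.1.symm)]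
    rcases h t a' (M.reachLE_self_iff.2 ⟨v, hv⟩) ht with ⟨rfl, ha⟩ | ⟨hst, u₀, hu₀, hle⟩
    · rcases (hu.2 hv).lt_or_eq with h' | h'
      · exact Or.inl h'
      · exact Or.inr ⟨h', ha⟩
    · refine Or.inl (lt_of_le_of_ne ((hu.2 hu₀).trans (hle v hv)) ?_)
      rintro rfl
      exact hst (hu.1.2.symm.trans hv.2)

end DFA

/-! ### Minimal representatives in terms of states -/

/-- The reachable states that come first in their class for `E`, in terms of the comparison `J`
of the reachable states. -/
def firstStates {σ : Type*} (J E : σ → σ → Prop) : Set σ :=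
  {s | J s s ∧ ∀ t, J t t → E s t → J s t}

/-- `s` is the element number `q` of `firstStates J E`. -/
def IsNthFirst {σ : Type*} (J E : σ → σ → Prop) (q : ℕ) (s : σ) : Prop :=
  s ∈ firstStates J E ∧ {t ∈ firstStates J E | t ≠ s ∧ J t s}.ncard = q

namespace DFA.RecognizesWith

variable {A B σ : Type*} {M : DFA (A × B) σ} {b : ℕ → List B} {L : Language A}

/-- The total length `n` fixes the advice word, so `M` after a prefix of length `i` and the advice
after `i` determine which continuations of length `n - i` are accepted. -/
theorem mnEquiv_iff (hM : M.RecognizesWith b L) (hb : ∀ n, (b n).length = n) {n i : ℕ}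
    (hi : i ≤ n) {u v : List A} (hu : u.length = i) (hv : v.length = i) :
    MNEquiv L (n - i) u v ↔ M.suffixEquiv ((b n).drop i) (M.eval (u.zip ((b n).take i)))
      (M.eval (v.zip ((b n).take i))) := by
  have key : ∀ u w : List A, u.length = i → w.length = n - i → (u ++ w ∈ L ↔
      M.evalFrom (M.eval (u.zip ((b n).take i))) (w.zip ((b n).drop i)) ∈ M.accept) := by
    intro u w hu hw
    rw [hM, show (u ++ w).length = n by simp [hu, hw, hi]]
    conv_lhs => rw [← List.take_append_drop i (b n), List.zip_append (by simp [hb, hu, hi])]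
    rw [DFA.eval, DFA.evalFrom_of_append]
  have hd : ((b n).drop i).length = n - i := by simp [hb]
  constructor
  · intro h w hw
    rw [hd] at hw
    rw [← key u w hu hw, ← key v w hv hw]
    exact h w hw
  · intro h w hw
    rw [key u w hu hw, key v w hv hw]
    exact h w (hw.trans hd.symm)

variable [LinearOrder A] [Finite A]

/-- Each equivalence class is a union of sets of words reaching a common state, so its least word is
the least word of one of these states, namely the one that comes first. -/
theorem mem_minReps_iff (hM : M.RecognizesWith b L) (hb : ∀ n, (b n).length = n) {n i : ℕ}
    (hi : i ≤ n) {u : List A} : u ∈ minReps L n i ↔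
      ∃ s ∈ firstStates (M.reachLE ((b n).take i)) (M.suffixEquiv ((b n).drop i)),
        IsLeast (M.reaching ((b n).take i) s) u := by
  have hc : ((b n).take i).length = i := by simp [hb, hi]
  constructor
  · rintro ⟨hu, hmin⟩
    have hur := M.mem_reaching_eval (hu.trans hc.symm)
    have hle : ∀ t, M.suffixEquiv ((b n).drop i) (M.eval (u.zip ((b n).take i))) t →
        ∀ v ∈ M.reaching ((b n).take i) t, u ≤ v := by
      rintro t hE v ⟨hv, rfl⟩
      exact not_lt.1 (hmin v (hv.trans hc) ((hM.mnEquiv_iff hb hi hu (hv.trans hc)).2 hE))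
    have hself := hle _ fun _ _ => Iff.rfl
    exact ⟨_, ⟨⟨u, hur, hself⟩, fun t _ hE => ⟨u, hur, hle t hE⟩⟩, hur, hself⟩
  · rintro ⟨s, ⟨_, hmin⟩, hu⟩
    refine ⟨hu.1.1.trans hc, fun v hv hE => (not_lt.2 ?_ : ¬ v < u)⟩
    have hvr := M.mem_reaching_eval (hv.trans hc.symm)
    rw [hM.mnEquiv_iff hb hi (hu.1.1.trans hc) hv, hu.1.2] at hE
    obtain ⟨u₀, hu₀, h⟩ := hmin _ (M.reachLE_self_iff.2 ⟨v, hvr⟩) hE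
    exact (hu.2 hu₀).trans (h v hvr)

theorem isRep_iff (hM : M.RecognizesWith b L) (hb : ∀ n, (b n).length = n) {n i q : ℕ}
    (hi : i ≤ n) {u : List A} : IsRep L n i q u ↔
      ∃ s, IsNthFirst (M.reachLE ((b n).take i)) (M.suffixEquiv ((b n).drop i)) q s ∧
        IsLeast (M.reaching ((b n).take i) s) u := by
  have hcard : ∀ s, IsLeast (M.reaching ((b n).take i) s) u →
      {v ∈ minReps L n i | List.Lex (· < ·) v u}.ncard =
      {t ∈ firstStates (M.reachLE ((b n).take i)) (M.suffixEquiv ((b n).drop i)) |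
        t ≠ s ∧ M.reachLE ((b n).take i) t s}.ncard := by
    intro s hu
    -- Sending a representative to the state it reaches is an order-preserving bijection onto the
    -- first states, so ranks agree.
    refine Set.ncard_congr (fun v _ => M.eval (v.zip ((b n).take i))) ?_ ?_ ?_
    · rintro v ⟨hv, hlt⟩
      have hlt : v < u := hlt
      obtain ⟨t, ht, hvt⟩ := (hM.mem_minReps_iff hb hi).1 hv
      rw [hvt.1.2]
      refine ⟨ht, ?_, (M.reachLE_iff_le hvt hu).2 hlt.le⟩
      rintro rfl
      exact hlt.ne (hvt.unique hu)
    · rintro v w ⟨hv, _⟩ ⟨hw, _⟩ h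
      obtain ⟨t, _, hvt⟩ := (hM.mem_minReps_iff hb hi).1 hv
      obtain ⟨t', _, hwt⟩ := (hM.mem_minReps_iff hb hi).1 hw
      rw [hvt.1.2, hwt.1.2] at h
      subst h
      exact hvt.unique hwt
    · rintro t ⟨ht, hne, hle⟩
      obtain ⟨v, hv⟩ := M.exists_isLeast_reaching (M.reachLE_self_iff.1 ht.1)
      refine ⟨v, ⟨(hM.mem_minReps_iff hb hi).2 ⟨t, ht, hv⟩, ?_⟩, hv.1.2⟩
      refine lt_of_le_of_ne ((M.reachLE_iff_le hv hu).1 hle) ?_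
      rintro rfl
      exact hne (hv.1.2.symm.trans hu.1.2)
  constructor
  · rintro ⟨hu, hq⟩
    obtain ⟨s, hs, hus⟩ := (hM.mem_minReps_iff hb hi).1 hu
    exact ⟨s, ⟨hs, (hcard s hus).symm.trans hq⟩, hus⟩
  · rintro ⟨s, ⟨hs, hq⟩, hus⟩
    exact ⟨(hM.mem_minReps_iff hb hi).2 ⟨s, hs, hus⟩, (hcard s hus).trans hq⟩

end DFA.RecognizesWith

/-! ### The marked automaton and definability of the syntactical predicate -/

namespace DFA

variable {A B σ : Type*} [LinearOrder A]

open Classical in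
/-- The automaton reading an advice word with a marked position `i` that computes `reachLE` for the
part before `i`, the advice at `i`, `reachPairs` for the part after `i`, and whether that part is
empty; it accepts if these data satisfy `F`. -/
noncomputable def marked (M : DFA (A × B) σ)
    (F : (σ → σ → Prop) → B → (σ → σ → Set (σ × σ)) → Prop → Prop) :
    DFA (B × Prop) ((σ → σ → Prop) ⊕ ((σ → σ → Prop) × B × (σ → σ → Set (σ × σ)) × Prop)) where
  step x c := match x with
    | .inl J => if c.2 then .inr (J, c.1, M.reachPairs [], True) else .inl (M.nextLE J c.1)
    | .inr y => .inr (y.1, y.2.1, M.nextPairs y.2.2.1 c.1, False)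
  start := .inl (M.reachLE [])
  accept := {x | ∃ y, x = .inr y ∧ F y.1 y.2.1 y.2.2.1 y.2.2.2}

theorem marked_eval [Finite A] (M : DFA (A × B) σ)
    (F : (σ → σ → Prop) → B → (σ → σ → Set (σ × σ)) → Prop → Prop) (c : List B) (b : B)
    (d : List B) :
    (M.marked F).eval (c.map (fun e => (e, False)) ++ (b, True) :: d.map (fun e => (e, False))) =
      .inr (M.reachLE c, b, M.reachPairs d, d = []) := by
  have hc : (M.marked F).eval (c.map (fun e => (e, False))) = .inl (M.reachLE c) := by
    induction c using List.reverseRecOn with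
    | nil => rfl
    | append_singleton c e ih =>
      rw [List.map_append, List.map_singleton, eval_append_singleton, ih,
        reachLE_append_singleton]
      simp [marked]
  induction d using List.reverseRecOn with
  | nil =>
    rw [List.map_nil, eval_append_singleton, hc]
    simp [marked]
  | append_singleton d e ih =>
    rw [List.map_append, List.map_singleton, ← List.cons_append, ← List.append_assoc,
      eval_append_singleton, ih, reachPairs_append_singleton]
    simp [marked]

theorem marked_eval_mem_accept [Finite A] (M : DFA (A × B) σ)
    (F : (σ → σ → Prop) → B → (σ → σ → Set (σ × σ)) → Prop → Prop) {n : ℕ} (b : Fin n → B)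
    (i : Fin n) :
    (M.marked F).eval (List.ofFn fun j => (b j, i = j)) ∈ (M.marked F).accept ↔
      F (M.reachLE ((List.ofFn b).take i)) (b i) (M.reachPairs ((List.ofFn b).drop (i + 1)))
        ((i : ℕ) + 1 = n) := by
  have hword : (List.ofFn fun j => (b j, i = j)) =
      ((List.ofFn b).take i).map (fun e => (e, False)) ++
        (b i, True) :: ((List.ofFn b).drop (i + 1)).map (fun e => (e, False)) := by
    have hi := i.2
    refine List.ext_getElem (by simp; lia) fun j hj hj' => ?_
    simp only [List.length_ofFn] at hj
    rw [List.getElem_ofFn]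
    rcases lt_trichotomy j i with h | h | h
    · rw [List.getElem_append_left (by simp; lia)]
      simp [Fin.ext_iff, h.ne']
    · subst h
      rw [List.getElem_append_right (by simp)]
      simp [hi.le]
    · obtain ⟨k, rfl⟩ := Nat.exists_eq_add_of_lt h
      rw [List.getElem_append_right (by simp; lia)]
      have hk : (i : ℕ) + k + 1 - min (i : ℕ) n = k + 1 := by
        rw [min_eq_left hi.le]; lia
      simp only [List.length_map, List.length_take, List.length_ofFn, hk, List.getElem_cons_succ,
        List.getElem_map, List.getElem_drop, List.getElem_ofFn, Prod.mk.injEq, eq_iff_iff,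
        iff_false]
      refine ⟨?_, ?_⟩
      · congr 2
        lia
      · rw [Fin.ext_iff]
        simp only
        lia
  have hlast : ((List.ofFn b).drop (i + 1) = []) = ((i : ℕ) + 1 = n) := by
    have hi := i.2
    simp only [List.drop_eq_nil_iff, List.length_ofFn, eq_iff_iff]
    lia
  rw [hword, marked_eval, hlast]
  constructor
  · rintro ⟨y, hy, hF⟩
    cases hy
    exact hF
  · exact fun h => ⟨_, rfl, h⟩

end DFA

/-- Membership in the syntactical predicates, in terms of the data computed by `DFA.marked`. -/
def synCondition {A B σ : Type*} [LinearOrder A] (M : DFA (A × B) σ) {K : ℕ} :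
    SynSymbol A K → (σ → σ → Prop) → B → (σ → σ → Set (σ × σ)) → Prop → Prop
  | .trans q a q', J, b, G, _ => ∃ s t,
      IsNthFirst J (M.consEquiv (M.equivOfPairs G) b) q s ∧
      IsNthFirst (M.nextLE J b) (M.equivOfPairs G) q' t ∧
      M.equivOfPairs G (M.step s (a, b)) t
  | .final q, J, b, G, last => last ∧ ∃ s,
      IsNthFirst (M.nextLE J b) (M.equivOfPairs G) q s ∧ s ∈ M.accept

/-- The data split `n` at position `i`. Representatives of length `i` see the advice at `i` as part
of the suffix (`consEquiv`), those of length `i + 1` see it as part of the prefix (`nextLE`). -/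
theorem DFA.RecognizesWith.mem_synPred_iff {A B σ : Type*} [LinearOrder A] [Finite A]
    {M : DFA (A × B) σ} {b : ∀ n, Fin n → B} {L : Language A}
    (hM : M.RecognizesWith (fun n => List.ofFn (b n)) L) {K : ℕ} (s : SynSymbol A K) {n : ℕ}
    (i : Fin n) : i ∈ synPred L K s n ↔
      synCondition M s (M.reachLE ((List.ofFn (b n)).take i)) (b n i)
        (M.reachPairs ((List.ofFn (b n)).drop (i + 1))) ((i : ℕ) + 1 = n) := by
  have hb : ∀ n, (List.ofFn (b n)).length = n := fun n => by simp
  have hi : (i : ℕ) < (List.ofFn (b n)).length := by simp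
  have htake : (List.ofFn (b n)).take (i + 1) = (List.ofFn (b n)).take i ++ [b n i] := by
    rw [← List.take_append_getElem hi]
    simp
  have hdrop : (List.ofFn (b n)).drop i = b n i :: (List.ofFn (b n)).drop (i + 1) := by
    rw [List.drop_eq_getElem_cons hi]
    simp
  have hlen : ((List.ofFn (b n)).take i).length = i := by simp [i.2.le]
  have hlen' : ((List.ofFn (b n)).take (i + 1)).length = i + 1 := by simp [Nat.succ_le_of_lt i.2]
  have hnext : ∀ {q : ℕ} {v : List A}, IsRep L n (i + 1) q v ↔
      ∃ s, IsNthFirst (M.nextLE (M.reachLE ((List.ofFn (b n)).take i)) (b n i))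
        (M.equivOfPairs (M.reachPairs ((List.ofFn (b n)).drop (i + 1)))) q s ∧
        IsLeast (M.reaching ((List.ofFn (b n)).take (i + 1)) s) v := by
    intro q v
    rw [hM.isRep_iff hb i.2, M.equivOfPairs_reachPairs, ← M.reachLE_append_singleton, ← htake]
  have hexists : ∀ {E : σ → σ → Prop} {q : ℕ} {s : σ},
      IsNthFirst (M.nextLE (M.reachLE ((List.ofFn (b n)).take i)) (b n i)) E q s →
        ∃ v, IsLeast (M.reaching ((List.ofFn (b n)).take (i + 1)) s) v := by
    intro E q s hs
    rw [← M.reachLE_append_singleton, ← htake] at hs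
    exact M.exists_isLeast_reaching (M.reachLE_self_iff.1 hs.1.1)
  cases s with
  | trans q a q' =>
    have hequiv : ∀ {s t : σ} {u v : List A}, u ∈ M.reaching ((List.ofFn (b n)).take i) s →
        v ∈ M.reaching ((List.ofFn (b n)).take (i + 1)) t →
        (MNEquiv L (n - (i + 1)) (u ++ [a]) v ↔
          M.equivOfPairs (M.reachPairs ((List.ofFn (b n)).drop (i + 1)))
            (M.step s (a, b n i)) t) := by
      rintro s t u v ⟨hu, rfl⟩ ⟨hv, rfl⟩
      rw [hM.mnEquiv_iff hb i.2 (by rw [List.length_append, hu, hlen]; rfl) (hv.trans hlen'),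
        M.equivOfPairs_reachPairs, htake, M.eval_zip_append_singleton hu]
    have hcur : ∀ {q : ℕ} {u : List A}, IsRep L n i q u ↔
        ∃ s, IsNthFirst (M.reachLE ((List.ofFn (b n)).take i)) (M.consEquiv
          (M.equivOfPairs (M.reachPairs ((List.ofFn (b n)).drop (i + 1)))) (b n i)) q s ∧
          IsLeast (M.reaching ((List.ofFn (b n)).take i) s) u := by
      intro q u
      rw [hM.isRep_iff hb i.2.le, M.equivOfPairs_reachPairs, ← M.suffixEquiv_cons, ← hdrop]
    constructor
    · rintro ⟨u, v, hu, hv, huv⟩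
      obtain ⟨s, hs, hus⟩ := hcur.1 hu
      obtain ⟨t, ht, hvt⟩ := hnext.1 hv
      exact ⟨s, t, hs, ht, (hequiv hus.1 hvt.1).1 huv⟩
    · rintro ⟨s, t, hs, ht, h⟩
      obtain ⟨u, hu⟩ := M.exists_isLeast_reaching (M.reachLE_self_iff.1 hs.1.1)
      obtain ⟨v, hv⟩ := hexists ht
      exact ⟨u, v, hcur.2 ⟨s, hs, hu⟩, hnext.2 ⟨t, ht, hv⟩, (hequiv hu.1 hv.1).2 h⟩
  | final q =>
    refine and_congr_right fun hlast => ?_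
    have hacc : ∀ {s : σ} {v : List A}, v ∈ M.reaching ((List.ofFn (b n)).take (i + 1)) s →
        (v ∈ L ↔ s ∈ M.accept) := by
      rintro s v ⟨hv, rfl⟩
      have hvn : v.length = n := (hv.trans hlen').trans hlast
      rw [hM, hvn, List.take_of_length_le (by simp [hlast])]
    constructor
    · rintro ⟨u, hu, huL⟩
      rw [← hlast] at hu
      obtain ⟨s, hs, hus⟩ := hnext.1 (by rwa [hlast] at hu ⊢)
      exact ⟨s, hs, (hacc hus.1).1 huL⟩
    · rintro ⟨s, hs, hsacc⟩
      obtain ⟨v, hv⟩ := hexists hs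
      have hrep := hnext.2 ⟨s, hs, hv⟩
      rw [hlast] at hrep
      exact ⟨v, hrep, (hacc hv.1).2 hsacc⟩

/-- The syntactical predicate is definable from every tuple of predicates that defines the
language. -/
theorem LanguageDefinable.predicateDefinable_synPred {A : Type*} [Finite A] [LinearOrder A]
    {ι : Type} [Finite ι] {P : ι → NumPred} {L : Language A} (hL : LanguageDefinable P L) {K : ℕ}
    (s : SynSymbol A K) : PredicateDefinable P (synPred L K s) := by
  obtain ⟨σ, _, M, hM⟩ := (languageDefinable_iff P L).1 hL
  refine predicateDefinable_of_dfa (M.marked (synCondition M s)) fun n i => ?_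
  rw [DFA.marked_eval_mem_accept]
  exact DFA.RecognizesWith.mem_synPred_iff (b := fun n j => {s | j ∈ P s n}) hM s i

/-- A language recognized by a finite automaton with advice has boundedly many classes. -/
theorem DFA.RecognizesWith.hasClassBound {A B σ : Type*} [Finite σ] {M : DFA (A × B) σ}
    {b : ℕ → List B} {L : Language A} (hM : M.RecognizesWith b L)
    (hb : ∀ n, (b n).length = n) : HasClassBound L (Nat.card σ) := by
  intro i p
  refine Nat.card_le_card_of_injective
    -- A class is sent to the state reached by a chosen member along the advice for total length `i
    -- + p`.
    (fun c => M.eval (c.out.1.zip ((b (i + p)).take i))) fun c c' h => ?_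
  rw [← c.out_eq, ← c'.out_eq]
  refine Quotient.sound ?_
  have := (hM.mnEquiv_iff hb (Nat.le_add_right i p) c.out.2 c'.out.2).2
    (by intro w _; simp only at h; rw [h])
  rwa [Nat.add_sub_cancel_left] at this

/-! ### Existence and uniqueness of representatives -/

section Representatives

variable {A : Type*} {L : Language A} {n i : ℕ}

theorem MNEquiv.symm {p : ℕ} {u v : List A} (h : MNEquiv L p u v) : MNEquiv L p v u :=
  fun w hw => (h w hw).symm

theorem MNEquiv.trans {p : ℕ} {u v w : List A} (h : MNEquiv L p u v) (h' : MNEquiv L p v w) :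
    MNEquiv L p u w :=
  fun x hx => (h x hx).trans (h' x hx)

theorem MNEquiv.append_singleton {p : ℕ} {u v : List A} (h : MNEquiv L (p + 1) u v) (a : A) :
    MNEquiv L p (u ++ [a]) (v ++ [a]) := by
  intro w hw
  simpa using h (a :: w) (by simpa using hw)

variable [LinearOrder A]

theorem eq_of_mem_minReps {u v : List A} (hu : u ∈ minReps L n i) (hv : v ∈ minReps L n i)
    (h : MNEquiv L (n - i) u v) : u = v :=
  le_antisymm (not_lt.1 (hu.2 v hv.1 h)) (not_lt.1 (hv.2 u hu.1 h.symm))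

theorem finite_minReps [Finite A] : (minReps L n i).Finite :=
  (List.finite_length_eq A i).subset fun _ hu => hu.1

theorem IsRep.eq [Finite A] {q : ℕ} {u v : List A} (hu : IsRep L n i q u)
    (hv : IsRep L n i q v) : u = v := by
  have key : ∀ {u v : List A}, IsRep L n i q u → IsRep L n i q v → ¬ u < v := by
    intro u v hu hv huv
    have hss : {w ∈ minReps L n i | List.Lex (· < ·) w u} ⊂
        {w ∈ minReps L n i | List.Lex (· < ·) w v} := by
      refine ⟨fun w hw => ⟨hw.1, (show w < v from lt_trans hw.2 huv)⟩, fun hsub => ?_⟩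
      exact lt_irrefl u (hsub ⟨hu.1, huv⟩).2
    have := Set.ncard_lt_ncard hss (finite_minReps.subset fun _ hw => hw.1)
    rw [hu.2, hv.2] at this
    exact this.ne rfl
  exact le_antisymm (not_lt.1 (key hv hu)) (not_lt.1 (key hu hv))

theorem HasClassBound.exists_isRep [Finite A] {K : ℕ} (hK : HasClassBound L K) {w : List A}
    (hw : w.length = i) : ∃ (q : Fin K) (u : List A), IsRep L n i q u ∧ MNEquiv L (n - i) w u := by
  have hfin : {v : List A | v.length = i ∧ MNEquiv L (n - i) w v}.Finite :=
    (List.finite_length_eq A i).subset fun u hu => hu.1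
  obtain ⟨u, hu, hmin⟩ := hfin.exists_minimalFor id _ ⟨w, hw, fun _ _ => Iff.rfl⟩
  have hrep : u ∈ minReps L n i :=
    ⟨hu.1, fun v hv huv hlt => (show v < u from hlt).not_ge (hmin ⟨hv, hu.2.trans huv⟩
      (show v < u from hlt).le)⟩
  have hle : (minReps L n i).ncard ≤ K := by
    have : Finite {u : List A // u.length = i} := List.finite_length_eq A i
    refine le_trans ?_ (hK i (n - i))
    rw [← Nat.card_coe_set_eq]
    refine Nat.card_le_card_of_injective
      (fun v => Quotient.mk (mnSetoid L (n - i) i) ⟨v.1, v.2.1⟩) fun v v' h => ?_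
    exact Subtype.ext (eq_of_mem_minReps v.2 v'.2 (Quotient.exact h))
  -- The index of `u` counts the representatives below it, a proper subset since `u` is left out;
  -- hence it is less than the number of classes.
  refine ⟨⟨_, lt_of_lt_of_le (Set.ncard_lt_ncard ?_ finite_minReps) hle⟩, u, ⟨hrep, rfl⟩, hu.2⟩
  exact ⟨fun v hv => hv.1, fun hsub => lt_irrefl u (hsub hrep).2⟩

theorem isRep_zero_iff {q : ℕ} {u : List A} : IsRep L n 0 q u ↔ u = [] ∧ q = 0 := by
  have hmem : ∀ u : List A, u ∈ minReps L n 0 ↔ u = [] := by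
    intro u
    constructor
    · exact fun hu => List.length_eq_zero_iff.1 hu.1
    · rintro rfl
      exact ⟨rfl, fun v _ _ => List.not_lt_nil v⟩
  have hempty : {v ∈ minReps L n 0 | List.Lex (· < ·) v []} = ∅ :=
    Set.eq_empty_of_forall_notMem fun v hv => List.not_lt_nil v hv.2
  rw [IsRep, hmem]
  refine and_congr_right ?_
  rintro rfl
  rw [hempty, Set.ncard_empty, eq_comm]

end Representatives

/-! ### The automaton driven by the syntactical predicate -/

section SynAutomaton

variable {A : Type*} [LinearOrder A] {L : Language A} {K : ℕ}

/-- The automaton that follows the class of the prefix read so far with the help of the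
syntactical predicate. The second component of a state tells whether this prefix is in the
language if it is the whole word. -/
def synDFA (L : Language A) (K : ℕ) : DFA (A × Set (SynSymbol A K)) (Set (Fin K) × Prop) where
  step x c :=
    ({q' | ∃ q ∈ x.1, SynSymbol.trans q c.1 q' ∈ c.2},
      ∃ q', (∃ q ∈ x.1, SynSymbol.trans q c.1 q' ∈ c.2) ∧ SynSymbol.final q' ∈ c.2)
  start := ({q | (q : ℕ) = 0}, [] ∈ L)
  accept := {x | x.2}

/-- The indices of the representative of the class of a word. -/
def classIndices (L : Language A) (K n i : ℕ) (w : List A) : Set (Fin K) :=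
  {q | ∃ u, IsRep L n i q u ∧ MNEquiv L (n - i) w u}

/-- Equivalence is preserved by appending a letter, with one letter less to come; so the class of `w
a` depends only on `a` and the representative of `w`. Such a representative has an index below `K`
by `hK`, and each index names at most one word. -/
theorem classIndices_succ [Finite A] (hK : HasClassBound L K) {n : ℕ} (i : Fin n) {w : List A}
    (hw : w.length = i) (a : A) : classIndices L K n (i + 1) (w ++ [a]) =
      {q' | ∃ q ∈ classIndices L K n i w, i ∈ synPred L K (.trans q a q') n} := by
  have hstep : ∀ {u : List A}, MNEquiv L (n - i) w u →
      MNEquiv L (n - (i + 1)) (w ++ [a]) (u ++ [a]) := by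
    intro u hu
    rw [show n - (i : ℕ) = n - (i + 1) + 1 by lia] at hu
    exact hu.append_singleton a
  ext q'
  constructor
  · rintro ⟨v, hv, hwv⟩
    obtain ⟨q, u, hu, hwu⟩ := hK.exists_isRep (n := n) hw
    exact ⟨q, ⟨u, hu, hwu⟩, u, v, hu, hv, (hstep hwu).symm.trans hwv⟩
  · rintro ⟨q, ⟨u, hu, hwu⟩, u', v, hu', hv, huv⟩
    obtain rfl := hu.eq hu'
    exact ⟨v, hv, (hstep hwu).trans huv⟩

theorem synDFA_step_eval_take (w : List A) {i : ℕ} (hi : i < w.length) :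
    (synDFA L K).eval ((w.zip (advice (synPred L K) w.length)).take (i + 1)) =
      (synDFA L K).step ((synDFA L K).eval ((w.zip (advice (synPred L K) w.length)).take i))
        (w[i], {s | (⟨i, hi⟩ : Fin w.length) ∈ synPred L K s w.length}) := by
  rw [← List.take_append_getElem (by simpa using hi), DFA.eval_append_singleton,
    List.getElem_zip, getElem_advice]

theorem synDFA_eval_take_fst [Finite A] (hK : HasClassBound L K) (w : List A) {i : ℕ}
    (hi : i ≤ w.length) :
    ((synDFA L K).eval ((w.zip (advice (synPred L K) w.length)).take i)).1 =
      classIndices L K w.length i (w.take i) := by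
  induction i with
  | zero =>
    ext q
    change (q : ℕ) = 0 ↔ ∃ u, IsRep L w.length 0 q u ∧ MNEquiv L _ [] u
    simp only [isRep_zero_iff]
    constructor
    · exact fun hq => ⟨[], ⟨rfl, hq⟩, fun _ _ => Iff.rfl⟩
    · exact fun ⟨_, hu, _⟩ => hu.2
  | succ i ih =>
    rw [synDFA_step_eval_take w hi, ← List.take_append_getElem hi,
      classIndices_succ hK ⟨i, hi⟩ (by simp; lia), ← ih (Nat.le_of_succ_le hi)]
    rfl

theorem synDFA_recognizesWith [Finite A] (hK : HasClassBound L K) :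
    (synDFA L K).RecognizesWith (advice (synPred L K)) L := by
  intro w
  rcases Nat.eq_zero_or_pos w.length with h0 | hpos
  -- Without positions the predicates carry no information; membership of the empty word is stored
  -- in the start state.
  · obtain rfl := List.length_eq_zero_iff.1 h0
    rfl
  · obtain ⟨i, hi⟩ : ∃ i, i + 1 = w.length := ⟨w.length - 1, by lia⟩
    have hfst := synDFA_eval_take_fst hK w hi.le
    have hstep := synDFA_step_eval_take (L := L) (K := K) w (i := i) (by lia)
    have hw : (w.zip (advice (synPred L K) w.length)).take (i + 1) =
        w.zip (advice (synPred L K) w.length) := List.take_of_length_le (by simp [hi])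
    rw [hstep] at hfst
    rw [← hw, hstep]
    change w ∈ L ↔ ∃ q', (q' ∈ ((synDFA L K).step _ _).1) ∧ _
    rw [hfst, hi, List.take_length]
    -- At full length only the empty continuation remains, so equivalence is agreement on membership
    -- in `L`.
    have hL : ∀ {u : List A}, MNEquiv L (w.length - w.length) w u → (w ∈ L ↔ u ∈ L) := by
      intro u hu
      simpa using hu [] (by simp)
    constructor
    · intro hwL
      obtain ⟨q, u, hu, hwu⟩ := hK.exists_isRep (n := w.length) (rfl : w.length = w.length)
      exact ⟨q, ⟨u, hu, hwu⟩, hi, u, hu, (hL hwu).1 hwL⟩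
    · rintro ⟨q, ⟨u, hu, hwu⟩, _, u', hu', huL⟩
      obtain rfl := hu.eq hu'
      exact (hL hwu).2 huL

end SynAutomaton

/-! ### Assembly of the theorem -/

instance {A : Type*} [Finite A] {K : ℕ} : Finite (SynSymbol A K) := by
  refine Finite.of_injective (β := (Fin K × A × Fin K) ⊕ Fin K)
    (fun | .trans q a q' => .inl (q, a, q') | .final q => .inr q) ?_
  rintro (⟨q, a, q'⟩ | q) (⟨r, b, r'⟩ | r) h <;> simp_all

theorem mainTheorem3 {A : Type*} [Finite A] [LinearOrder A] (L : Language A)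
    (hL : AdviceRegular L) :
    (∃ K : ℕ, HasClassBound L K) ∧
    ∀ K : ℕ, HasClassBound L K →
      LanguageDefinable (synPred L K) L ∧
      (∀ (k : ℕ) (P : Fin k → NumPred), LanguageDefinable P L →
        ∀ s : SynSymbol A K, PredicateDefinable P (synPred L K s)) ∧
      (L.IsRegular ↔ ∀ s : SynSymbol A K, (synPred L K s).IsRegular) := by
  refine ⟨?_, fun K hK => ?_⟩
  · obtain ⟨k, P, hP⟩ := hL
    obtain ⟨σ, _, M, hM⟩ := (languageDefinable_iff P L).1 hP
    exact ⟨_, hM.hasClassBound (length_advice P)⟩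
  · have hdef : LanguageDefinable (synPred L K) L :=
      (languageDefinable_iff _ L).2 ⟨_, Fintype.ofFinite _, _, synDFA_recognizesWith hK⟩
    refine ⟨hdef, fun k P hP s => hP.predicateDefinable_synPred s, ?_⟩
    rw [isRegular_iff_languageDefinable]
    exact ⟨fun h s => h.predicateDefinable_synPred s, fun h => hdef.trans h⟩
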